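/- Let $\mathbb E^4_1$ be $\mathbb R^4$ with the metric $\langle u,v\rangle=u_1v_1+u_2v_2+u_3v_3-u_4v_4$. Let $a,b$ be nonzero real constants, let $I\subset\mathbb R$ be a nonempty open interval, and let $x,w:I\to\mathbb R$ be smooth functions with $x'(s)^2-w'(s)^2=-1$ on $I$. Consider the double rotational surface $M$ given by $$r(s,t)=\bigl(x(s)\cos at,\;x(s)\sin at,\;w(s)\sinh bt,\;w(s)\cosh bt\bigr),\qquad s\in I,\ t\in(0,2\pi),$$ and assume that $r$ is a timelike immersion, i.e. that the induced metric is Lorentzian. Assume that $M$ has flat normal bundle, i.e. that the curvature tensor $R^D$ of the normal connection vanishes identically. Let $\nu=e_3\wedge e_4:M\to\bigwedge^2\mathbb E^4_1$ be the Gauss map of $M$, where $(e_3,e_4)$ is an oriented orthonormal frame of the normal bundle, and let $\Delta$ be the Laplace operator of the induced metric, $\Delta=\sum_{i=1}^2\varepsilon_i(\nabla_{e_i}e_i-e_ie_i)$ for a local orthonormal tangent frame $e_1,e_2$ with $\varepsilon_i=\langle e_i,e_i\rangle$. Then $M$ has pointwise 1-type Gauss map of the second kind, that is, there are a smooth real-valued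 function $f$ on $M$ and a constant bivector $C\in\bigwedge^2\mathbb E^4_1$, $C\neq 0$, with $$\Delta\nu=f(\nu+C)\quad\text{on }M,$$ if and only if $M$ is an open part of a timelike plane of $\mathbb E^4_1$. -/

import Mathlib

open scoped ContDiff

noncomputable section

namespace Minkowski4

/-- The underlying vector space of Minkowski space `𝔼⁴₁`. Its (finite-dimensional) topology
is the only part of the normed structure that is used, for derivatives and openness. -/
abbrev E41 : Type := Fin 4 → ℝ

/-- The canonical Lorentzian metric `dx₁² + dx₂² + dx₃² - dx₄²`. -/
def mink (u v : E41) : ℝ := u 0 * v 0 + u 1 * v 1 + u 2 * v 2 - u 3 * v 3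

/-- The space `⋀² 𝔼⁴₁` of bivectors. -/
abbrev Bivector : Type := ⋀[ℝ]^2 E41

/-- The bivector `u ∧ v`. -/
def wedge (u v : E41) : Bivector := exteriorPower.ιMulti ℝ 2 ![u, v]

section Partial

variable {V : Type*} [NormedAddCommGroup V] [NormedSpace ℝ V]

/-- The partial derivative `∂F/∂s` at `p = (s, t)`. -/
def partialS (F : ℝ × ℝ → V) (p : ℝ × ℝ) : V := deriv (fun s => F (s, p.2)) p.1

/-- The partial derivative `∂F/∂t` at `p = (s, t)`. -/
def partialT (F : ℝ × ℝ → V) (p : ℝ × ℝ) : V := deriv (fun t => F (p.1, t)) p.2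

end Partial

/-! ### Parametrized surfaces `r : U → 𝔼⁴₁`, with `U` open in the `(s, t)`-plane -/

/-- The coefficient `E = ⟨r_s, r_s⟩` of the induced metric. -/
def metricE (r : ℝ × ℝ → E41) (p : ℝ × ℝ) : ℝ := mink (partialS r p) (partialS r p)

/-- The coefficient `F = ⟨r_s, r_t⟩` of the induced metric. -/
def metricF (r : ℝ × ℝ → E41) (p : ℝ × ℝ) : ℝ := mink (partialS r p) (partialT r p)

/-- The coefficient `G = ⟨r_t, r_t⟩` of the induced metric. -/
def metricG (r : ℝ × ℝ → E41) (p : ℝ × ℝ) : ℝ := mink (partialT r p) (partialT r p)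

/-- The determinant `E G - F²` of the induced metric. -/
def metricDet (r : ℝ × ℝ → E41) (p : ℝ × ℝ) : ℝ :=
  metricE r p * metricG r p - metricF r p ^ 2

/-- `r` is a smooth timelike immersed surface on `U`: the induced metric is Lorentzian, that is,
has negative determinant (in particular `r_s`, `r_t` are linearly independent). -/
def IsTimelikeSurface (r : ℝ × ℝ → E41) (U : Set (ℝ × ℝ)) : Prop :=
  ContDiffOn ℝ ∞ r U ∧ ∀ p ∈ U, metricDet r p < 0

/-- The Laplace operator of the induced metric `g` on functions, with the geometers' sign:
`Δ φ = - |g|^{-1/2} ∂ᵢ (|g|^{1/2} gⁱʲ ∂ⱼ φ)`. For a local orthonormal tangent frame this is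
`∑ εᵢ (∇_{eᵢ} eᵢ - eᵢ eᵢ) φ`. -/
def laplacian (r : ℝ × ℝ → E41) (φ : ℝ × ℝ → ℝ) (p : ℝ × ℝ) : ℝ :=
  -(1 / √|metricDet r p|) *
    (partialS (fun z => √|metricDet r z| / metricDet r z *
        (metricG r z * partialS φ z - metricF r z * partialT φ z)) p +
      partialT (fun z => √|metricDet r z| / metricDet r z *
        (metricE r z * partialT φ z - metricF r z * partialS φ z)) p)

/-- `v` is normal to the surface at `p`. -/
def IsNormalAt (r : ℝ × ℝ → E41) (p : ℝ × ℝ) (v : E41) : Prop :=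
  mink v (partialS r p) = 0 ∧ mink v (partialT r p) = 0

/-- The component of `v` tangent to the surface at `p`. -/
def tangentPart (r : ℝ × ℝ → E41) (p : ℝ × ℝ) (v : E41) : E41 :=
  ((metricG r p * mink v (partialS r p) - metricF r p * mink v (partialT r p)) /
      metricDet r p) • partialS r p +
    ((metricE r p * mink v (partialT r p) - metricF r p * mink v (partialS r p)) /
      metricDet r p) • partialT r p

/-- The component of `v` normal to the surface at `p`. -/
def normalPart (r : ℝ × ℝ → E41) (p : ℝ × ℝ) (v : E41) : E41 := v - tangentPart r p v

/-- The normal connection `D_{∂s} ξ`. -/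
def normalDerivS (r : ℝ × ℝ → E41) (ξ : ℝ × ℝ → E41) (p : ℝ × ℝ) : E41 :=
  normalPart r p (partialS ξ p)

/-- The normal connection `D_{∂t} ξ`. -/
def normalDerivT (r : ℝ × ℝ → E41) (ξ : ℝ × ℝ → E41) (p : ℝ × ℝ) : E41 :=
  normalPart r p (partialT ξ p)

/-- The normal curvature `R^D(∂s, ∂t) ξ = D_{∂s} D_{∂t} ξ - D_{∂t} D_{∂s} ξ`
(recall `[∂s, ∂t] = 0`). -/
def normalCurvature (r : ℝ × ℝ → E41) (ξ : ℝ × ℝ → E41) (p : ℝ × ℝ) : E41 :=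
  normalDerivS r (normalDerivT r ξ) p - normalDerivT r (normalDerivS r ξ) p

/-- Flat normal bundle: `R^D = 0`. As `R^D(X, Y)` is tensorial and alternating in the tangent
vectors `X`, `Y`, it is enough to take `X = ∂s`, `Y = ∂t`. -/
def HasFlatNormalBundle (r : ℝ × ℝ → E41) (U : Set (ℝ × ℝ)) : Prop :=
  ∀ ξ : ℝ × ℝ → E41, ContDiffOn ℝ ∞ ξ U → (∀ p ∈ U, IsNormalAt r p (ξ p)) →
    ∀ p ∈ U, normalCurvature r ξ p = 0

/-- `(n₁, n₂)` is an orthonormal basis of the normal plane at `p` of a timelike surface (so both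
vectors are spacelike) such that `(r_s, r_t, n₁, n₂)` is a positively oriented basis of `𝔼⁴₁`. -/
def IsOrientedNormalFrameAt (r : ℝ × ℝ → E41) (p : ℝ × ℝ) (n₁ n₂ : E41) : Prop :=
  IsNormalAt r p n₁ ∧ IsNormalAt r p n₂ ∧
    mink n₁ n₁ = 1 ∧ mink n₂ n₂ = 1 ∧ mink n₁ n₂ = 0 ∧
    0 < Matrix.det (Matrix.of ![partialS r p, partialT r p, n₁, n₂])

/-- `ν` is the Gauss map `p ↦ n₁ ∧ n₂` of the timelike surface `r` on `U`, oriented by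
`(∂s, ∂t)`. The bivector `n₁ ∧ n₂` does not depend on the oriented orthonormal normal frame. -/
def IsGaussMap (r : ℝ × ℝ → E41) (U : Set (ℝ × ℝ)) (ν : ℝ × ℝ → Bivector) : Prop :=
  ∀ p ∈ U, ∃ n₁ n₂ : E41, IsOrientedNormalFrameAt r p n₁ n₂ ∧ ν p = wedge n₁ n₂

/-- `Δ ν = f (ν + C)` on `U`, where the Laplacian of a map into the vector space `⋀² 𝔼⁴₁` is
taken componentwise: for every linear functional `ℓ`, `Δ (ℓ ∘ ν) = ℓ (f (ν + C))`. -/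
def GaussMapEquation (r : ℝ × ℝ → E41) (U : Set (ℝ × ℝ)) (ν : ℝ × ℝ → Bivector)
    (f : ℝ × ℝ → ℝ) (C : Bivector) : Prop :=
  ∀ p ∈ U, ∀ ℓ : Module.Dual ℝ Bivector,
    laplacian r (fun z => ℓ (ν z)) p = ℓ (f p • (ν p + C))

/-- Pointwise 1-type Gauss map of the second kind: the Gauss map satisfies `Δ ν = f (ν + C)` for
some smooth function `f` on the surface and some constant bivector `C ≠ 0`. -/
def HasPointwiseOneTypeGaussMapSecondKind (r : ℝ × ℝ → E41) (U : Set (ℝ × ℝ)) : Prop :=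
  ∃ ν : ℝ × ℝ → Bivector, IsGaussMap r U ν ∧
    ∃ f : ℝ × ℝ → ℝ, ContDiffOn ℝ ∞ f U ∧
      ∃ C : Bivector, C ≠ 0 ∧ GaussMapEquation r U ν f C

/-- `P` is a timelike plane: an affine 2-plane whose direction contains a timelike vector, that
is, on which the metric is Lorentzian. -/
def IsTimelikePlane (P : AffineSubspace ℝ E41) : Prop :=
  Module.finrank ℝ P.direction = 2 ∧ ∃ v ∈ P.direction, mink v v < 0

/-- The surface `r(U)` is an open part (a relatively open subset) of a timelike plane. -/
def IsOpenPartOfTimelikePlane (r : ℝ × ℝ → E41) (U : Set (ℝ × ℝ)) : Prop :=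
  ∃ P : AffineSubspace ℝ E41, IsTimelikePlane P ∧
    r '' U ⊆ (P : Set E41) ∧ IsOpen {z : P | (z : E41) ∈ r '' U}

/-! ### Double rotational surfaces -/

/-- The double rotational surface
`(x(s) cos at, x(s) sin at, w(s) sinh bt, w(s) cosh bt)`. -/
def doubleRotational (a b : ℝ) (x w : ℝ → ℝ) (p : ℝ × ℝ) : E41 :=
  ![x p.1 * Real.cos (a * p.2), x p.1 * Real.sin (a * p.2),
    w p.1 * Real.sinh (b * p.2), w p.1 * Real.cosh (b * p.2)]

/-- The parameter domain `I × (0, 2π)`. -/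
def paramDomain (I : Set ℝ) : Set (ℝ × ℝ) := I ×ˢ Set.Ioo 0 (2 * Real.pi)

end Minkowski4

end

noncomputable section

namespace Minkowski4

/-! Everything is expressed in a moving frame carried along by the double rotations: `frame₁`
$=r_s$, `frame₂` $=r_t/q$ with $q=|r_t|$, and normals `frame₃`, `frame₄`; write $e_1,\dots,e_4$. Its
derivatives involve only functions of $s$: κ (`curv`), μ (`mixed`) and λ (`rotCurv`) describe the
second fundamental form, τ (`torsion`) the normal connection. The Ricci equation reads
$\tau'=q\mu(\kappa-\lambda)$, so a flat normal bundle means $\mu(\kappa-\lambda)=0$ and τ is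
constant on the interval.

By `laplacian_form`, under flatness $\Delta(e_3\wedge e_4)$ lies in the span of $e_3\wedge e_4$,
$e_1\wedge e_4$, $e_2\wedge e_3$. Hence where $f\ne0$ the constant bivector $C$ lies in that span
too. Differentiating the vanishing of its other components gives linear relations between the three
remaining ones (`exists_components`), and $\mu\ne0$ would force $C=0$. Where $f=0$, the Laplacian
itself vanishes and its coefficients give equations on κ, λ, μ, τ.

If τ vanished at one point it would vanish identically; then μ has no zero, so $f=0$ at every
sampled point, and this makes $q$ constant and $w=0$, which is absurd (`torsion_ne_zero`). With
$\tau\ne0$ one obtains successively $\mu=0$, $\kappa=0$, $\lambda=0$, and $\mu=\lambda=0$ means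
$x=0$. The surface is then an open piece of the plane $x_1=x_2=0$.

Conversely, a surface inside a plane has vanishing second fundamental form, so $\mu=\lambda=0$ and
again $x=0$. Then $\Delta\nu=0$, and $f=0$ works with any nonzero $C$. -/

/-! ### The bilinear form `⟨·,·⟩` and functionals on bivectors -/

/-- The Lorentzian metric as a bilinear map. -/
def minkL : E41 →ₗ[ℝ] E41 →ₗ[ℝ] ℝ :=
  LinearMap.mk₂ ℝ mink
    (fun u u' v => by simp only [mink, Pi.add_apply]; ring)
    (fun c u v => by simp only [mink, Pi.smul_apply, smul_eq_mul]; ring)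
    (fun u v v' => by simp only [mink, Pi.add_apply]; ring)
    (fun c u v => by simp only [mink, Pi.smul_apply, smul_eq_mul]; ring)

@[simp] lemma minkL_apply (u v : E41) : minkL u v = mink u v := rfl

lemma mink_comm (u v : E41) : mink u v = mink v u := by simp only [mink]; ring

lemma mink_add_left (u v z : E41) : mink (u + v) z = mink u z + mink v z := by
  simp only [mink, Pi.add_apply]; ring

lemma mink_add_right (u v z : E41) : mink u (v + z) = mink u v + mink u z := by
  simp only [mink, Pi.add_apply]; ring

lemma mink_smul_left (c : ℝ) (u v : E41) : mink (c • u) v = c * mink u v := by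
  simp only [mink, Pi.smul_apply, smul_eq_mul]; ring

lemma mink_smul_right (c : ℝ) (u v : E41) : mink u (c • v) = c * mink u v := by
  simp only [mink, Pi.smul_apply, smul_eq_mul]; ring

lemma update_pair_zero (u v z : E41) : Function.update ![u, v] 0 z = ![z, v] := by
  ext i; fin_cases i <;> rfl

lemma update_pair_one (u v z : E41) : Function.update ![u, v] 1 z = ![u, z] := by
  ext i; fin_cases i <;> rfl

lemma wedge_add_left (u u' v : E41) : wedge (u + u') v = wedge u v + wedge u' v := by
  have := (exteriorPower.ιMulti ℝ 2 (M := E41)).map_update_add ![u, v] 0 u u'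
  simpa only [wedge, update_pair_zero, update_pair_one] using this

lemma wedge_add_right (u v v' : E41) : wedge u (v + v') = wedge u v + wedge u v' := by
  have := (exteriorPower.ιMulti ℝ 2 (M := E41)).map_update_add ![u, v] 1 v v'
  simpa only [wedge, update_pair_zero, update_pair_one] using this

lemma wedge_smul_left (c : ℝ) (u v : E41) : wedge (c • u) v = c • wedge u v := by
  have := (exteriorPower.ιMulti ℝ 2 (M := E41)).map_update_smul ![u, v] 0 c u
  simpa only [wedge, update_pair_zero, update_pair_one] using this

lemma wedge_smul_right (c : ℝ) (u v : E41) : wedge u (c • v) = c • wedge u v := by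
  have := (exteriorPower.ιMulti ℝ 2 (M := E41)).map_update_smul ![u, v] 1 c v
  simpa only [wedge, update_pair_zero, update_pair_one] using this

lemma wedge_self (u : E41) : wedge u u = 0 :=
  (exteriorPower.ιMulti ℝ 2 (M := E41)).map_eq_zero_of_eq ![u, u] (i := 0) (j := 1) rfl
    (by decide)

lemma wedge_swap (u v : E41) : wedge v u = -wedge u v := by
  have h := wedge_self (u + v)
  rw [wedge_add_left, wedge_add_right, wedge_add_right, wedge_self, wedge_self, zero_add,
    add_zero] at h
  exact eq_neg_of_add_eq_zero_right h

/-- The bilinear form `(u, v) ↦ ℓ (u ∧ v)`. -/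
def wedgeForm (ℓ : Module.Dual ℝ Bivector) : E41 →ₗ[ℝ] E41 →ₗ[ℝ] ℝ :=
  LinearMap.mk₂ ℝ (fun u v => ℓ (wedge u v))
    (fun u u' v => by simp only [wedge_add_left, map_add])
    (fun c u v => by simp only [wedge_smul_left, map_smul])
    (fun u v v' => by simp only [wedge_add_right, map_add])
    (fun c u v => by simp only [wedge_smul_right, map_smul])

@[simp] lemma wedgeForm_apply (ℓ : Module.Dual ℝ Bivector) (u v : E41) :
    wedgeForm ℓ u v = ℓ (wedge u v) := rfl

/-- The alternating map `(y, z) ↦ ⟨u, y⟩⟨v, z⟩ - ⟨u, z⟩⟨v, y⟩`. -/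
def pairAlt (u v : E41) : E41 [⋀^Fin 2]→ₗ[ℝ] ℝ where
  toFun m := mink u (m 0) * mink v (m 1) - mink u (m 1) * mink v (m 0)
  map_update_add' m i y z := by
    -- The field quantifies over an arbitrary `DecidableEq (Fin 2)` instance; with the canonical one
    -- `Function.update` can be evaluated.
    rename_i inst
    rw [Subsingleton.elim inst (instDecidableEqFin 2)]
    fin_cases i <;> simp [mink_add_right] <;> ring
  map_update_smul' m i c y := by
    rename_i inst
    rw [Subsingleton.elim inst (instDecidableEqFin 2)]
    fin_cases i <;> simp [mink_smul_right] <;> ring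
  map_eq_zero_of_eq' m i j h hij := by
    fin_cases i <;> fin_cases j <;> simp_all

/-- The functional on bivectors induced by the metric: `⟨u ∧ v, ·⟩`. -/
def pair (u v : E41) : Module.Dual ℝ Bivector :=
  exteriorPower.alternatingMapLinearEquiv (pairAlt u v)

lemma pair_wedge (u v y z : E41) :
    pair u v (wedge y z) = mink u y * mink v z - mink u z * mink v y := by
  rw [pair, wedge, exteriorPower.alternatingMapLinearEquiv_apply_ιMulti]
  rfl

/-- The bilinear form `(u, v) ↦ ⟨u ∧ v, C⟩`. -/
def pairForm (C : Bivector) : E41 →ₗ[ℝ] E41 →ₗ[ℝ] ℝ :=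
  LinearMap.mk₂ ℝ (fun u v => pair u v C)
    (fun u u' v => by
      have : pairAlt (u + u') v = pairAlt u v + pairAlt u' v := by
        ext m; simp [pairAlt, mink_add_left]; ring
      simp only [pair, this, map_add, LinearMap.add_apply])
    (fun c u v => by
      have : pairAlt (c • u) v = c • pairAlt u v := by
        ext m; simp [pairAlt, mink_smul_left]; ring
      simp only [pair, this, map_smul, LinearMap.smul_apply])
    (fun u v v' => by
      have : pairAlt u (v + v') = pairAlt u v + pairAlt u v' := by
        ext m; simp [pairAlt, mink_add_left]; ring
      simp only [pair, this, map_add, LinearMap.add_apply])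
    (fun c u v => by
      have : pairAlt u (c • v) = c • pairAlt u v := by
        ext m; simp [pairAlt, mink_smul_left]; ring
      simp only [pair, this, map_smul, LinearMap.smul_apply])

@[simp] lemma pairForm_apply (C : Bivector) (u v : E41) : pairForm C u v = pair u v C := rfl

lemma pairForm_self (C : Bivector) (u : E41) : pairForm C u u = 0 := by
  have : pairAlt u u = 0 := by ext m; simp [pairAlt]; ring
  simp [pair, this]

lemma form_swap {W : E41 →ₗ[ℝ] E41 →ₗ[ℝ] ℝ} (hW : ∀ u, W u u = 0) (u v : E41) :
    W v u = -W u v := by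
  have h := hW (u + v)
  simp only [map_add, LinearMap.add_apply, hW] at h
  linarith

/-- One product rule serves both uses of bilinear forms: `wedgeForm ℓ` for components of the Gauss
map, and `pairForm C` for components of the constant bivector along the moving frame. -/
lemma HasDerivAt.form (W : E41 →ₗ[ℝ] E41 →ₗ[ℝ] ℝ) {u v : ℝ → E41} {u' v' : E41} {s : ℝ}
    (hu : HasDerivAt u u' s) (hv : HasDerivAt v v' s) :
    HasDerivAt (fun s => W (u s) (v s)) (W u' (v s) + W (u s) v') s := by
  have h := ((LinearMap.toContinuousBilinearMap W).hasFDerivAt_of_bilinear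
    hu.hasFDerivAt hv.hasFDerivAt).hasDerivAt
  simpa [add_comm] using h

/-! ### Rotating frame -/

/-- The vector with constant components `α, β, γ, δ` in the frame that is adapted to the
one-parameter group of double rotations. -/
def rot (a b t α β γ δ : ℝ) : E41 :=
  ![α * Real.cos (a * t) - β * Real.sin (a * t), α * Real.sin (a * t) + β * Real.cos (a * t),
    γ * Real.sinh (b * t) + δ * Real.cosh (b * t), γ * Real.cosh (b * t) + δ * Real.sinh (b * t)]

section rot
variable (a b t : ℝ)

lemma mink_rot (α β γ δ α' β' γ' δ' : ℝ) :
    mink (rot a b t α β γ δ) (rot a b t α' β' γ' δ') = α * α' + β * β' - γ * γ' + δ * δ' := by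
  have h1 := Real.sin_sq_add_cos_sq (a * t)
  have h2 := Real.cosh_sq (b * t)
  simp only [mink, rot, Matrix.cons_val]
  linear_combination (α * α' + β * β') * h1 + (δ * δ' - γ * γ') * h2

lemma rot_add (α β γ δ α' β' γ' δ' : ℝ) :
    rot a b t α β γ δ + rot a b t α' β' γ' δ' =
      rot a b t (α + α') (β + β') (γ + γ') (δ + δ') := by
  ext i; fin_cases i <;> simp [rot] <;> ring

lemma rot_smul (c α β γ δ : ℝ) :
    c • rot a b t α β γ δ = rot a b t (c * α) (c * β) (c * γ) (c * δ) := by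
  ext i; fin_cases i <;> simp [rot] <;> ring

lemma exists_rot (v : E41) : ∃ α β γ δ : ℝ, v = rot a b t α β γ δ := by
  have h1 := Real.sin_sq_add_cos_sq (a * t)
  have h2 := Real.cosh_sq (b * t)
  -- The inverse rotation and the inverse boost applied to `v`.
  refine ⟨v 0 * Real.cos (a * t) + v 1 * Real.sin (a * t),
    v 1 * Real.cos (a * t) - v 0 * Real.sin (a * t),
    v 3 * Real.cosh (b * t) - v 2 * Real.sinh (b * t),
    v 2 * Real.cosh (b * t) - v 3 * Real.sinh (b * t), ?_⟩
  ext i; fin_cases i <;> simp [rot]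
  · linear_combination (-v 0) * h1
  · linear_combination (-v 1) * h1
  · linear_combination (-v 2) * h2
  · linear_combination (-v 3) * h2

/-- The even and odd slots span orthogonal planes, so the determinant splits into two minors times
that of the coefficients `c`, `d`. The last two rows have the shape of combinations of `frame₃` and
`frame₄`. -/
lemma det_rot (α β γ δ α' β' γ' δ' c₁ d₁ c₂ d₂ : ℝ) :
    Matrix.det (Matrix.of ![rot a b t α 0 γ 0, rot a b t 0 β 0 δ,
      rot a b t (c₁ * α') (d₁ * β') (c₁ * γ') (d₁ * δ'),
      rot a b t (c₂ * α') (d₂ * β') (c₂ * γ') (d₂ * δ')]) =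
      (d₁ * c₂ - c₁ * d₂) * (α * γ' - γ * α') * (β * δ' - δ * β') := by
  have h1 := Real.sin_sq_add_cos_sq (a * t)
  have h2 := Real.cosh_sq (b * t)
  simp only [Matrix.det_succ_row_zero, Fin.sum_univ_succ, rot]
  simp [Fin.succAbove]
  linear_combination (d₁ * c₂ - c₁ * d₂) * (α * γ' - γ * α') * (β * δ' - δ * β') *
    ((Real.cosh (b * t) ^ 2 - Real.sinh (b * t) ^ 2) * h1 + h2)

lemma hasDerivAt_rot_coeff {α β γ δ : ℝ → ℝ} {α' β' γ' δ' s : ℝ} (hα : HasDerivAt α α' s)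
    (hβ : HasDerivAt β β' s) (hγ : HasDerivAt γ γ' s) (hδ : HasDerivAt δ δ' s) :
    HasDerivAt (fun s => rot a b t (α s) (β s) (γ s) (δ s)) (rot a b t α' β' γ' δ') s := by
  rw [hasDerivAt_pi]
  intro i
  fin_cases i
  · exact (hα.mul_const _).sub (hβ.mul_const _)
  · exact (hα.mul_const _).add (hβ.mul_const _)
  · exact (hγ.mul_const _).add (hδ.mul_const _)
  · exact (hγ.mul_const _).add (hδ.mul_const _)

lemma contDiffOn_rot {n : WithTop ℕ∞} {U : Set (ℝ × ℝ)} {α β γ δ : ℝ × ℝ → ℝ}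
    (hα : ContDiffOn ℝ n α U) (hβ : ContDiffOn ℝ n β U) (hγ : ContDiffOn ℝ n γ U)
    (hδ : ContDiffOn ℝ n δ U) :
    ContDiffOn ℝ n (fun p => rot a b p.2 (α p) (β p) (γ p) (δ p)) U := by
  rw [contDiffOn_pi]
  intro i
  fin_cases i <;> simp [rot] <;> fun_prop

lemma hasDerivAt_rot (α β γ δ : ℝ) :
    HasDerivAt (fun t => rot a b t α β γ δ) (rot a b t (-a * β) (a * α) (b * δ) (b * γ)) t := by
  have ha : HasDerivAt (fun t => a * t) a t := by simpa using (hasDerivAt_id t).const_mul a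
  have hb : HasDerivAt (fun t => b * t) b t := by simpa using (hasDerivAt_id t).const_mul b
  rw [hasDerivAt_pi]
  intro i
  fin_cases i
  · exact ((ha.cos.const_mul α).sub (ha.sin.const_mul β)).congr_deriv (by simp [rot]; ring)
  · exact ((ha.sin.const_mul α).add (ha.cos.const_mul β)).congr_deriv (by simp [rot]; ring)
  · exact ((hb.sinh.const_mul γ).add (hb.cosh.const_mul δ)).congr_deriv (by simp [rot]; ring)
  · exact ((hb.cosh.const_mul γ).add (hb.sinh.const_mul δ)).congr_deriv (by simp [rot]; ring)

end rot

lemma doubleRotational_eq_rot (a b : ℝ) (x w : ℝ → ℝ) (p : ℝ × ℝ) :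
    doubleRotational a b x w p = rot a b p.2 (x p.1) 0 (w p.1) 0 := by
  simp [doubleRotational, rot]

/-! ### Profile curves and the adapted frame -/

/-- The data of a timelike double rotational surface with unit speed profile curve `(x, w)`. -/
structure IsProfile (a b : ℝ) (x w : ℝ → ℝ) (I : Set ℝ) : Prop where
  isOpen : IsOpen I
  contDiffOn_x : ContDiffOn ℝ ∞ x I
  contDiffOn_w : ContDiffOn ℝ ∞ w I
  arc : ∀ s ∈ I, deriv x s ^ 2 - deriv w s ^ 2 = -1
  pos : ∀ s ∈ I, 0 < a ^ 2 * x s ^ 2 + b ^ 2 * w s ^ 2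

section scalars
variable (a b : ℝ) (x w : ℝ → ℝ) (s : ℝ)

/-- The length of `∂r/∂t`. -/
def speed : ℝ := √(a ^ 2 * x s ^ 2 + b ^ 2 * w s ^ 2)

/-- The derivative of `speed`. -/
def speedDeriv : ℝ := (a ^ 2 * x s * deriv x s + b ^ 2 * w s * deriv w s) / speed a b x w s

/-- The curvature of the profile curve. -/
def curv : ℝ := deriv (deriv x) s * deriv w s - deriv (deriv w) s * deriv x s

/-- The off-diagonal coefficient of the second fundamental form. -/
def mixed : ℝ := a * b * (deriv x s * w s - x s * deriv w s) / speed a b x w s ^ 2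

/-- The second diagonal coefficient of the second fundamental form. -/
def rotCurv : ℝ :=
  (a ^ 2 * x s * deriv w s + b ^ 2 * w s * deriv x s) / speed a b x w s ^ 2

/-- The coefficient of the normal connection form in direction `∂t`. -/
def torsion : ℝ := a * b * (w s * deriv w s - x s * deriv x s) / speed a b x w s

end scalars

section frame
variable (a b : ℝ) (x w : ℝ → ℝ) (p : ℝ × ℝ)

/-- The unit tangent vector in direction `∂s`. -/
def frame₁ : E41 := rot a b p.2 (deriv x p.1) 0 (deriv w p.1) 0

/-- The unit tangent vector in direction `∂t`. -/
def frame₂ : E41 :=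
  rot a b p.2 0 (a * x p.1 / speed a b x w p.1) 0 (b * w p.1 / speed a b x w p.1)

/-- The principal normal of the profile curve. -/
def frame₃ : E41 := rot a b p.2 (deriv w p.1) 0 (deriv x p.1) 0

/-- The second unit normal vector. -/
def frame₄ : E41 :=
  rot a b p.2 0 (b * w p.1 / speed a b x w p.1) 0 (-(a * x p.1) / speed a b x w p.1)

end frame

namespace IsProfile
variable {a b : ℝ} {x w : ℝ → ℝ} {I : Set ℝ} (h : IsProfile a b x w I)
include h

lemma hasDerivAt_x {s : ℝ} (hs : s ∈ I) : HasDerivAt x (deriv x s) s :=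
  ((h.contDiffOn_x.differentiableOn (by simp)).differentiableAt (h.isOpen.mem_nhds hs)).hasDerivAt

lemma hasDerivAt_w {s : ℝ} (hs : s ∈ I) : HasDerivAt w (deriv w s) s :=
  ((h.contDiffOn_w.differentiableOn (by simp)).differentiableAt (h.isOpen.mem_nhds hs)).hasDerivAt

lemma contDiffOn_deriv_x : ContDiffOn ℝ ∞ (deriv x) I :=
  h.contDiffOn_x.deriv_of_isOpen h.isOpen (by simp)

lemma contDiffOn_deriv_w : ContDiffOn ℝ ∞ (deriv w) I :=
  h.contDiffOn_w.deriv_of_isOpen h.isOpen (by simp)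

lemma contDiffOn_curv : ContDiffOn ℝ ∞ (curv x w) I :=
  ((h.contDiffOn_deriv_x.deriv_of_isOpen h.isOpen (by simp)).mul h.contDiffOn_deriv_w).sub
    ((h.contDiffOn_deriv_w.deriv_of_isOpen h.isOpen (by simp)).mul h.contDiffOn_deriv_x)

lemma hasDerivAt_curv {s : ℝ} (hs : s ∈ I) :
    HasDerivAt (curv x w) (deriv (curv x w) s) s :=
  ((h.contDiffOn_curv.differentiableOn (by simp)).differentiableAt
    (h.isOpen.mem_nhds hs)).hasDerivAt

/-- Frenet equations of a unit timelike curve in the Lorentzian plane: differentiating `arc` gives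
$x'x''=w'w''$, so the acceleration is a multiple of $(w',x')$. -/
lemma deriv_deriv {s : ℝ} (hs : s ∈ I) :
    deriv (deriv x) s = curv x w s * deriv w s ∧ deriv (deriv w) s = curv x w s * deriv x s := by
  have hx := ((h.contDiffOn_deriv_x.differentiableOn (by simp)).differentiableAt
    (h.isOpen.mem_nhds hs)).hasDerivAt
  have hw := ((h.contDiffOn_deriv_w.differentiableOn (by simp)).differentiableAt
    (h.isOpen.mem_nhds hs)).hasDerivAt
  have h1 := (hx.pow 2).sub (hw.pow 2)
  have h2 : HasDerivAt (deriv x ^ 2 - deriv w ^ 2) 0 s :=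
    (hasDerivAt_const s (-1 : ℝ)).congr_of_eventuallyEq
      (Filter.eventually_of_mem (h.isOpen.mem_nhds hs) fun z hz => h.arc z hz)
  have h3 := h1.unique h2
  have h4 := h.arc s hs
  simp only [Nat.cast_ofNat, Nat.add_one_sub_one, pow_one] at h3
  constructor
  · rw [curv]
    linear_combination -(deriv x s / 2) * h3 + deriv (deriv x) s * h4
  · rw [curv]
    linear_combination -(deriv w s / 2) * h3 + deriv (deriv w) s * h4

lemma hasDerivAt_deriv_x {s : ℝ} (hs : s ∈ I) :
    HasDerivAt (deriv x) (curv x w s * deriv w s) s := by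
  rw [← (h.deriv_deriv hs).1]
  exact ((h.contDiffOn_deriv_x.differentiableOn (by simp)).differentiableAt
    (h.isOpen.mem_nhds hs)).hasDerivAt

lemma hasDerivAt_deriv_w {s : ℝ} (hs : s ∈ I) :
    HasDerivAt (deriv w) (curv x w s * deriv x s) s := by
  rw [← (h.deriv_deriv hs).2]
  exact ((h.contDiffOn_deriv_w.differentiableOn (by simp)).differentiableAt
    (h.isOpen.mem_nhds hs)).hasDerivAt

lemma speed_sq {s : ℝ} (hs : s ∈ I) :
    speed a b x w s ^ 2 = a ^ 2 * x s ^ 2 + b ^ 2 * w s ^ 2 :=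
  Real.sq_sqrt (h.pos s hs).le

lemma speed_pos {s : ℝ} (hs : s ∈ I) : 0 < speed a b x w s := Real.sqrt_pos.2 (h.pos s hs)

lemma hasDerivAt_speed {s : ℝ} (hs : s ∈ I) :
    HasDerivAt (speed a b x w) (speedDeriv a b x w s) s := by
  have hx := h.hasDerivAt_x hs
  have hw := h.hasDerivAt_w hs
  have := (((hx.pow 2).const_mul (a ^ 2)).add ((hw.pow 2).const_mul (b ^ 2))).sqrt
    (h.pos s hs).ne'
  refine this.congr_deriv ?_
  have hq := (h.speed_pos hs).ne'
  change _ / (2 * speed a b x w s) = _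
  simp only [speedDeriv]
  field_simp
  simp
  ring

/-! #### Derivatives of the frame -/

lemma hasDerivAt_frame₁_s {p : ℝ × ℝ} (hp : p.1 ∈ I) :
    HasDerivAt (fun s => frame₁ a b x w (s, p.2)) (curv x w p.1 • frame₃ a b x w p) p.1 := by
  refine (hasDerivAt_rot_coeff a b p.2 (h.hasDerivAt_deriv_x hp) (hasDerivAt_const _ 0)
    (h.hasDerivAt_deriv_w hp) (hasDerivAt_const _ 0)).congr_deriv ?_
  rw [frame₃, rot_smul]
  simp

lemma hasDerivAt_frame₃_s {p : ℝ × ℝ} (hp : p.1 ∈ I) :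
    HasDerivAt (fun s => frame₃ a b x w (s, p.2)) (curv x w p.1 • frame₁ a b x w p) p.1 := by
  refine (hasDerivAt_rot_coeff a b p.2 (h.hasDerivAt_deriv_w hp) (hasDerivAt_const _ 0)
    (h.hasDerivAt_deriv_x hp) (hasDerivAt_const _ 0)).congr_deriv ?_
  rw [frame₁, rot_smul]
  simp

lemma hasDerivAt_frame₂_s {p : ℝ × ℝ} (hp : p.1 ∈ I) :
    HasDerivAt (fun s => frame₂ a b x w (s, p.2)) (mixed a b x w p.1 • frame₄ a b x w p) p.1 := by
  have hq := (h.speed_pos hp).ne'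
  have hq2 := h.speed_sq hp
  refine (hasDerivAt_rot_coeff a b p.2 (hasDerivAt_const _ 0)
    (((h.hasDerivAt_x hp).const_mul a).div (h.hasDerivAt_speed hp) hq) (hasDerivAt_const _ 0)
    (((h.hasDerivAt_w hp).const_mul b).div (h.hasDerivAt_speed hp) hq)).congr_deriv ?_
  rw [frame₄, rot_smul]
  congr 1
  · simp
  · simp only [mixed, speedDeriv]
    field_simp
    linear_combination a * deriv x p.1 * hq2
  · simp
  · simp only [mixed, speedDeriv]
    field_simp
    linear_combination b * deriv w p.1 * hq2

lemma hasDerivAt_frame₄_s {p : ℝ × ℝ} (hp : p.1 ∈ I) :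
    HasDerivAt (fun s => frame₄ a b x w (s, p.2)) (-mixed a b x w p.1 • frame₂ a b x w p) p.1 := by
  have hq := (h.speed_pos hp).ne'
  have hq2 := h.speed_sq hp
  refine (hasDerivAt_rot_coeff a b p.2 (hasDerivAt_const _ 0)
    (((h.hasDerivAt_w hp).const_mul b).div (h.hasDerivAt_speed hp) hq) (hasDerivAt_const _ 0)
    (((h.hasDerivAt_x hp).const_mul a).neg.div (h.hasDerivAt_speed hp) hq)).congr_deriv ?_
  rw [frame₂, rot_smul]
  congr 1
  · simp
  · simp only [mixed, speedDeriv]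
    field_simp
    linear_combination b * deriv w p.1 * hq2
  · simp
  · simp only [mixed, speedDeriv, Pi.neg_apply]
    field_simp
    linear_combination -a * deriv x p.1 * hq2

lemma hasDerivAt_frame₁_t {p : ℝ × ℝ} (hp : p.1 ∈ I) :
    HasDerivAt (fun t => frame₁ a b x w (p.1, t)) (speedDeriv a b x w p.1 • frame₂ a b x w p +
      (mixed a b x w p.1 * speed a b x w p.1) • frame₄ a b x w p) p.2 := by
  have hq := (h.speed_pos hp).ne'
  have hq2 := h.speed_sq hp
  refine (hasDerivAt_rot a b p.2 (deriv x p.1) 0 (deriv w p.1) 0).congr_deriv ?_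
  rw [frame₂, frame₄, rot_smul, rot_smul, rot_add]
  congr 1
  · simp
  · simp only [mixed, speedDeriv]
    field_simp
    linear_combination a * deriv x p.1 * hq2
  · simp
  · simp only [mixed, speedDeriv]
    field_simp
    linear_combination b * deriv w p.1 * hq2

lemma hasDerivAt_frame₂_t {p : ℝ × ℝ} (hp : p.1 ∈ I) :
    HasDerivAt (fun t => frame₂ a b x w (p.1, t)) (speedDeriv a b x w p.1 • frame₁ a b x w p +
      (-rotCurv a b x w p.1 * speed a b x w p.1) • frame₃ a b x w p) p.2 := by
  have hq := (h.speed_pos hp).ne'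
  have ha := h.arc _ hp
  refine (hasDerivAt_rot a b p.2 0 (a * x p.1 / speed a b x w p.1) 0
    (b * w p.1 / speed a b x w p.1)).congr_deriv ?_
  rw [frame₁, frame₃, rot_smul, rot_smul, rot_add]
  congr 1
  · simp only [rotCurv, speedDeriv]
    field_simp
    linear_combination -(a ^ 2 * x p.1) * ha
  · simp
  · simp only [rotCurv, speedDeriv]
    field_simp
    linear_combination b ^ 2 * w p.1 * ha
  · simp

lemma hasDerivAt_frame₃_t {p : ℝ × ℝ} (hp : p.1 ∈ I) :
    HasDerivAt (fun t => frame₃ a b x w (p.1, t))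
      ((rotCurv a b x w p.1 * speed a b x w p.1) • frame₂ a b x w p +
        torsion a b x w p.1 • frame₄ a b x w p) p.2 := by
  have hq := (h.speed_pos hp).ne'
  have hq2 := h.speed_sq hp
  refine (hasDerivAt_rot a b p.2 (deriv w p.1) 0 (deriv x p.1) 0).congr_deriv ?_
  rw [frame₂, frame₄, rot_smul, rot_smul, rot_add]
  congr 1
  · simp
  · simp only [rotCurv, torsion]
    field_simp
    linear_combination a * deriv w p.1 * hq2
  · simp
  · simp only [rotCurv, torsion]
    field_simp
    linear_combination b * deriv x p.1 * hq2

lemma hasDerivAt_frame₄_t {p : ℝ × ℝ} (hp : p.1 ∈ I) :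
    HasDerivAt (fun t => frame₄ a b x w (p.1, t))
      ((mixed a b x w p.1 * speed a b x w p.1) • frame₁ a b x w p +
        -torsion a b x w p.1 • frame₃ a b x w p) p.2 := by
  have hq := (h.speed_pos hp).ne'
  have ha := h.arc _ hp
  refine (hasDerivAt_rot a b p.2 0 (b * w p.1 / speed a b x w p.1) 0
    (-(a * x p.1) / speed a b x w p.1)).congr_deriv ?_
  rw [frame₁, frame₃, rot_smul, rot_smul, rot_add]
  congr 1
  · simp only [mixed, torsion]
    field_simp
    linear_combination -(a * b * w p.1) * ha
  · simp
  · simp only [mixed, torsion]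
    field_simp
    linear_combination -(a * b * x p.1) * ha
  · simp

/-- A Codazzi equation. Once μ vanishes identically it reduces to $\kappa\tau=0$. -/
lemma hasDerivAt_mixed {s : ℝ} (hs : s ∈ I) :
    HasDerivAt (mixed a b x w) (curv x w s * torsion a b x w s / speed a b x w s -
      2 * mixed a b x w s * speedDeriv a b x w s / speed a b x w s) s := by
  have hq := (h.speed_pos hs).ne'
  refine (((((h.hasDerivAt_deriv_x hs).mul (h.hasDerivAt_w hs)).sub
    ((h.hasDerivAt_x hs).mul (h.hasDerivAt_deriv_w hs))).const_mul (a * b)).div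
    ((h.hasDerivAt_speed hs).pow 2) (pow_ne_zero 2 hq)).congr_deriv ?_
  simp only [mixed, torsion, Pi.sub_apply, Pi.mul_apply, Pi.pow_apply]
  field_simp
  simp
  ring

/-- The Ricci equation: the right side is, up to the factor `speed`, the commutator of the two shape
operators. -/
lemma hasDerivAt_torsion {s : ℝ} (hs : s ∈ I) :
    HasDerivAt (torsion a b x w)
      (speed a b x w s * mixed a b x w s * (curv x w s - rotCurv a b x w s)) s := by
  have hq := (h.speed_pos hs).ne'
  have hq2 := h.speed_sq hs
  have ha := h.arc _ hs
  refine (((((h.hasDerivAt_w hs).mul (h.hasDerivAt_deriv_w hs)).sub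
    ((h.hasDerivAt_x hs).mul (h.hasDerivAt_deriv_x hs))).const_mul (a * b)).div
    (h.hasDerivAt_speed hs) hq).congr_deriv ?_
  simp only [mixed, speedDeriv, rotCurv, Pi.sub_apply, Pi.mul_apply]
  field_simp
  linear_combination a * b * (deriv w s ^ 2 - deriv x s ^ 2) * hq2

end IsProfile

namespace IsProfile
variable {a b : ℝ} {x w : ℝ → ℝ} {I : Set ℝ} (h : IsProfile a b x w I)
include h

/-! ### The induced metric -/

lemma partialS_doubleRotational {p : ℝ × ℝ} (hp : p.1 ∈ I) :
    partialS (doubleRotational a b x w) p = frame₁ a b x w p := by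
  simp only [partialS, doubleRotational_eq_rot]
  exact (hasDerivAt_rot_coeff a b p.2 (h.hasDerivAt_x hp) (hasDerivAt_const _ 0)
    (h.hasDerivAt_w hp) (hasDerivAt_const _ 0)).deriv

lemma partialT_doubleRotational {p : ℝ × ℝ} (hp : p.1 ∈ I) :
    partialT (doubleRotational a b x w) p = speed a b x w p.1 • frame₂ a b x w p := by
  simp only [partialT, doubleRotational_eq_rot]
  have hq := (h.speed_pos hp).ne'
  rw [(hasDerivAt_rot a b p.2 (x p.1) 0 (w p.1) 0).deriv, frame₂, rot_smul]
  congr 1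
  · simp
  · field_simp
  · simp
  · field_simp

lemma mink_frame₁_frame₁ {p : ℝ × ℝ} (hp : p.1 ∈ I) :
    mink (frame₁ a b x w p) (frame₁ a b x w p) = -1 := by
  rw [frame₁, mink_rot]
  linear_combination h.arc _ hp

omit h in
lemma mink_frame₁_frame₂ (p : ℝ × ℝ) : mink (frame₁ a b x w p) (frame₂ a b x w p) = 0 := by
  rw [frame₁, frame₂, mink_rot]; ring

omit h in
lemma mink_frame₁_frame₃ (p : ℝ × ℝ) : mink (frame₁ a b x w p) (frame₃ a b x w p) = 0 := by
  rw [frame₁, frame₃, mink_rot]; ring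

omit h in
lemma mink_frame₁_frame₄ (p : ℝ × ℝ) : mink (frame₁ a b x w p) (frame₄ a b x w p) = 0 := by
  rw [frame₁, frame₄, mink_rot]; ring

lemma mink_frame₂_frame₂ {p : ℝ × ℝ} (hp : p.1 ∈ I) :
    mink (frame₂ a b x w p) (frame₂ a b x w p) = 1 := by
  rw [frame₂, mink_rot]
  have hq := (h.speed_pos hp).ne'
  field_simp
  linear_combination -h.speed_sq hp

omit h in
lemma mink_frame₂_frame₃ (p : ℝ × ℝ) : mink (frame₂ a b x w p) (frame₃ a b x w p) = 0 := by
  rw [frame₂, frame₃, mink_rot]; ring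

omit h in
lemma mink_frame₂_frame₄ (p : ℝ × ℝ) : mink (frame₂ a b x w p) (frame₄ a b x w p) = 0 := by
  rw [frame₂, frame₄, mink_rot]; ring

lemma mink_frame₃_frame₃ {p : ℝ × ℝ} (hp : p.1 ∈ I) :
    mink (frame₃ a b x w p) (frame₃ a b x w p) = 1 := by
  rw [frame₃, mink_rot]
  linear_combination -h.arc _ hp

omit h in
lemma mink_frame₃_frame₄ (p : ℝ × ℝ) : mink (frame₃ a b x w p) (frame₄ a b x w p) = 0 := by
  rw [frame₃, frame₄, mink_rot]; ring

lemma mink_frame₄_frame₄ {p : ℝ × ℝ} (hp : p.1 ∈ I) :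
    mink (frame₄ a b x w p) (frame₄ a b x w p) = 1 := by
  rw [frame₄, mink_rot]
  have hq := (h.speed_pos hp).ne'
  field_simp
  linear_combination -h.speed_sq hp

lemma metricE_eq {p : ℝ × ℝ} (hp : p.1 ∈ I) : metricE (doubleRotational a b x w) p = -1 := by
  rw [metricE, h.partialS_doubleRotational hp, h.mink_frame₁_frame₁ hp]

lemma metricF_eq {p : ℝ × ℝ} (hp : p.1 ∈ I) : metricF (doubleRotational a b x w) p = 0 := by
  rw [metricF, h.partialS_doubleRotational hp, h.partialT_doubleRotational hp, mink_smul_right,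
    mink_frame₁_frame₂, mul_zero]

lemma metricG_eq {p : ℝ × ℝ} (hp : p.1 ∈ I) :
    metricG (doubleRotational a b x w) p = speed a b x w p.1 ^ 2 := by
  rw [metricG, h.partialT_doubleRotational hp, mink_smul_right, mink_smul_left,
    h.mink_frame₂_frame₂ hp]
  ring

lemma metricDet_eq {p : ℝ × ℝ} (hp : p.1 ∈ I) :
    metricDet (doubleRotational a b x w) p = -speed a b x w p.1 ^ 2 := by
  rw [metricDet, h.metricE_eq hp, h.metricF_eq hp, h.metricG_eq hp]
  ring

lemma sqrt_abs_metricDet {p : ℝ × ℝ} (hp : p.1 ∈ I) :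
    √|metricDet (doubleRotational a b x w) p| = speed a b x w p.1 := by
  rw [h.metricDet_eq hp, abs_neg, abs_of_nonneg (sq_nonneg _), Real.sqrt_sq (h.speed_pos hp).le]

/-! ### The Laplacian of the Gauss map -/

section laplacian
variable {W : E41 →ₗ[ℝ] E41 →ₗ[ℝ] ℝ} (hW : ∀ u, W u u = 0)
include hW

lemma partialS_form {p : ℝ × ℝ} (hp : p.1 ∈ I) :
    partialS (fun z => W (frame₃ a b x w z) (frame₄ a b x w z)) p =
      curv x w p.1 * W (frame₁ a b x w p) (frame₄ a b x w p) +
        mixed a b x w p.1 * W (frame₂ a b x w p) (frame₃ a b x w p) := by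
  refine (HasDerivAt.form W (h.hasDerivAt_frame₃_s hp) (h.hasDerivAt_frame₄_s hp)).deriv.trans ?_
  simp only [map_smul, LinearMap.smul_apply, smul_eq_mul]
  rw [form_swap hW (frame₂ a b x w p) (frame₃ a b x w p)]
  ring

lemma partialT_form {p : ℝ × ℝ} (hp : p.1 ∈ I) :
    partialT (fun z => W (frame₃ a b x w z) (frame₄ a b x w z)) p =
      speed a b x w p.1 * (rotCurv a b x w p.1 * W (frame₂ a b x w p) (frame₄ a b x w p) -
        mixed a b x w p.1 * W (frame₁ a b x w p) (frame₃ a b x w p)) := by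
  refine (HasDerivAt.form W (h.hasDerivAt_frame₃_t hp) (h.hasDerivAt_frame₄_t hp)).deriv.trans ?_
  simp only [map_smul, map_add, LinearMap.add_apply, LinearMap.smul_apply, smul_eq_mul, hW]
  rw [form_swap hW (frame₁ a b x w p) (frame₃ a b x w p)]
  ring

/-- Two applications of the product rule along the frame, with μ' replaced by means of the Codazzi
equation. The $e_1\wedge e_3$ and $e_2\wedge e_4$ terms cancel. -/
lemma laplacian_form {p : ℝ × ℝ} (hp : p.1 ∈ I) :
    laplacian (doubleRotational a b x w)
        (fun z => W (frame₃ a b x w z) (frame₄ a b x w z)) p =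
      (curv x w p.1 ^ 2 + rotCurv a b x w p.1 ^ 2 - 2 * mixed a b x w p.1 ^ 2) *
          W (frame₃ a b x w p) (frame₄ a b x w p) +
        2 * mixed a b x w p.1 * (rotCurv a b x w p.1 - curv x w p.1) *
          W (frame₁ a b x w p) (frame₂ a b x w p) +
        (deriv (curv x w) p.1 + ((curv x w p.1 - rotCurv a b x w p.1) * speedDeriv a b x w p.1 +
            mixed a b x w p.1 * torsion a b x w p.1) / speed a b x w p.1) *
          W (frame₁ a b x w p) (frame₄ a b x w p) +
        (curv x w p.1 + rotCurv a b x w p.1) * torsion a b x w p.1 / speed a b x w p.1 *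
          W (frame₂ a b x w p) (frame₃ a b x w p) := by
  have hq := (h.speed_pos hp).ne'
  rw [laplacian, h.sqrt_abs_metricDet hp]
  have hS : partialS (fun z => √|metricDet (doubleRotational a b x w) z| /
      metricDet (doubleRotational a b x w) z * (metricG (doubleRotational a b x w) z *
        partialS (fun z => W (frame₃ a b x w z) (frame₄ a b x w z)) z -
        metricF (doubleRotational a b x w) z *
        partialT (fun z => W (frame₃ a b x w z) (frame₄ a b x w z)) z)) p =
      deriv (fun s => -(speed a b x w s * (curv x w s *
        W (frame₁ a b x w (s, p.2)) (frame₄ a b x w (s, p.2)) + mixed a b x w s *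
        W (frame₂ a b x w (s, p.2)) (frame₃ a b x w (s, p.2))))) p.1 := by
    -- With $E=-1$, $F=0$, $G=q^2$ the flux in direction $s$ is $-q\,\varphi_s$.
    refine Filter.EventuallyEq.deriv_eq ?_
    filter_upwards [h.isOpen.mem_nhds hp] with s hs
    rw [h.sqrt_abs_metricDet (p := (s, p.2)) hs, h.metricDet_eq (p := (s, p.2)) hs,
      h.metricG_eq (p := (s, p.2)) hs, h.metricF_eq (p := (s, p.2)) hs,
      h.partialS_form hW (p := (s, p.2)) hs]
    have hq := (h.speed_pos hs).ne'
    field_simp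
    ring
  have hT : partialT (fun z => √|metricDet (doubleRotational a b x w) z| /
      metricDet (doubleRotational a b x w) z * (metricE (doubleRotational a b x w) z *
        partialT (fun z => W (frame₃ a b x w z) (frame₄ a b x w z)) z -
        metricF (doubleRotational a b x w) z *
        partialS (fun z => W (frame₃ a b x w z) (frame₄ a b x w z)) z)) p =
      deriv (fun t => rotCurv a b x w p.1 *
        W (frame₂ a b x w (p.1, t)) (frame₄ a b x w (p.1, t)) - mixed a b x w p.1 *
        W (frame₁ a b x w (p.1, t)) (frame₃ a b x w (p.1, t))) p.2 := by
    -- The flux in direction $t$ is $\varphi_t/q$. The formula holds for every real $t$, since only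
    -- the first coordinate has to lie in `I`.
    refine Filter.EventuallyEq.deriv_eq (Filter.Eventually.of_forall fun t => ?_)
    beta_reduce
    rw [h.sqrt_abs_metricDet (p := (p.1, t)) hp, h.metricDet_eq (p := (p.1, t)) hp,
      h.metricE_eq (p := (p.1, t)) hp, h.metricF_eq (p := (p.1, t)) hp,
      h.partialT_form hW (p := (p.1, t)) hp]
    field_simp
    ring
  rw [hS, hT]
  have dS := ((h.hasDerivAt_speed hp).mul
    (((h.hasDerivAt_curv hp).mul
      (HasDerivAt.form W (h.hasDerivAt_frame₁_s hp) (h.hasDerivAt_frame₄_s hp))).add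
    ((h.hasDerivAt_mixed hp).mul
      (HasDerivAt.form W (h.hasDerivAt_frame₂_s hp) (h.hasDerivAt_frame₃_s hp))))).neg
  have dT := ((HasDerivAt.form W (h.hasDerivAt_frame₂_t hp)
      (h.hasDerivAt_frame₄_t hp)).const_mul (rotCurv a b x w p.1)).sub
    ((HasDerivAt.form W (h.hasDerivAt_frame₁_t hp)
      (h.hasDerivAt_frame₃_t hp)).const_mul (mixed a b x w p.1))
  refine (congrArg₂ (fun y z => -(1 / speed a b x w p.1) * (y + z)) dS.deriv dT.deriv).trans ?_
  simp only [Pi.add_apply, Pi.mul_apply, Prod.mk.eta, map_smul, map_add, LinearMap.add_apply,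
    LinearMap.smul_apply, smul_eq_mul]
  rw [form_swap hW (frame₁ a b x w p) (frame₂ a b x w p),
    form_swap hW (frame₃ a b x w p) (frame₄ a b x w p)]
  field_simp
  ring

end laplacian

/-! ### The Gauss map -/

lemma eq_of_isNormalAt {p : ℝ × ℝ} (hp : p.1 ∈ I) {v : E41}
    (hv : IsNormalAt (doubleRotational a b x w) p v) :
    ∃ c d : ℝ, v = c • frame₃ a b x w p + d • frame₄ a b x w p := by
  have hq := (h.speed_pos hp).ne'
  have ha := h.arc _ hp
  have hq2 := h.speed_sq hp
  obtain ⟨α, β, γ, δ, rfl⟩ := exists_rot a b p.2 v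
  rw [IsNormalAt, h.partialS_doubleRotational hp, h.partialT_doubleRotational hp, mink_smul_right,
    frame₁, frame₂, mink_rot, mink_rot] at hv
  obtain ⟨h1, h2⟩ := hv
  field_simp at h2
  refine ⟨α * deriv w p.1 - γ * deriv x p.1,
    (β * (b * w p.1) - δ * (a * x p.1)) / speed a b x w p.1, ?_⟩
  rw [frame₃, frame₄, rot_smul, rot_smul, rot_add]
  congr 1
  · linear_combination -deriv x p.1 * h1 + α * ha
  · field_simp
    linear_combination a * x p.1 * h2 + β * hq2
  · linear_combination -deriv w p.1 * h1 + γ * ha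
  · field_simp
    linear_combination b * w p.1 * h2 + δ * hq2

lemma det_frame {p : ℝ × ℝ} (hp : p.1 ∈ I) (c₁ d₁ c₂ d₂ : ℝ) :
    Matrix.det (Matrix.of ![partialS (doubleRotational a b x w) p,
      partialT (doubleRotational a b x w) p, c₁ • frame₃ a b x w p + d₁ • frame₄ a b x w p,
      c₂ • frame₃ a b x w p + d₂ • frame₄ a b x w p]) =
      (d₁ * c₂ - c₁ * d₂) * speed a b x w p.1 := by
  have hq := (h.speed_pos hp).ne'
  rw [h.partialS_doubleRotational hp, h.partialT_doubleRotational hp, frame₁, frame₂, frame₃,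
    frame₄, rot_smul, rot_smul, rot_smul, rot_smul, rot_smul, rot_add, rot_add]
  simp only [mul_zero, add_zero, zero_add]
  rw [det_rot]
  field_simp
  linear_combination (d₁ * c₂ - c₁ * d₂) * (-(a ^ 2 * x p.1 ^ 2 + b ^ 2 * w p.1 ^ 2) * h.arc _ hp
    - h.speed_sq hp)

/-- Two orthonormal bases of the normal plane differ by an orthogonal matrix, whose determinant the
orientation fixes. The minus sign appears because $(r_s,r_t,e_3,e_4)$ is negatively oriented. -/
lemma wedge_eq_of_isOrientedNormalFrameAt {p : ℝ × ℝ} (hp : p.1 ∈ I) {n₁ n₂ : E41}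
    (hn : IsOrientedNormalFrameAt (doubleRotational a b x w) p n₁ n₂) :
    wedge n₁ n₂ = -wedge (frame₃ a b x w p) (frame₄ a b x w p) := by
  obtain ⟨hn₁, hn₂, h11, h22, h12, hdet⟩ := hn
  obtain ⟨c₁, d₁, rfl⟩ := h.eq_of_isNormalAt hp hn₁
  obtain ⟨c₂, d₂, rfl⟩ := h.eq_of_isNormalAt hp hn₂
  rw [h.det_frame hp] at hdet
  simp only [mink_add_left, mink_add_right, mink_smul_left, mink_smul_right,
    h.mink_frame₃_frame₃ hp, h.mink_frame₄_frame₄ hp, mink_frame₃_frame₄,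
    mink_comm (frame₄ a b x w p) (frame₃ a b x w p)] at h11 h22 h12
  have hpos : 0 < d₁ * c₂ - c₁ * d₂ := pos_of_mul_pos_left hdet (h.speed_pos hp).le
  -- Lagrange's identity: the squared determinant equals the Gram determinant, which is 1.
  have hsq : (d₁ * c₂ - c₁ * d₂ - 1) * (d₁ * c₂ - c₁ * d₂ + 1) = 0 := by
    linear_combination h11 * (c₂ ^ 2 + d₂ ^ 2) + h22 - (c₁ * c₂ + d₁ * d₂) * h12
  have h1 : c₁ * d₂ - d₁ * c₂ = -1 := by
    rcases mul_eq_zero.1 hsq with h | h <;> linarith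
  simp only [wedge_add_left, wedge_add_right, wedge_smul_left, wedge_smul_right, wedge_self,
    wedge_swap (frame₃ a b x w p) (frame₄ a b x w p)]
  generalize wedge (frame₃ a b x w p) (frame₄ a b x w p) = X
  trans (c₁ * d₂ - d₁ * c₂) • X
  · module
  · rw [h1]
    exact neg_one_smul ℝ X

lemma isOrientedNormalFrameAt {p : ℝ × ℝ} (hp : p.1 ∈ I) :
    IsOrientedNormalFrameAt (doubleRotational a b x w) p
      (frame₄ a b x w p) (frame₃ a b x w p) := by
  have hdet := h.det_frame hp 0 1 1 0
  simp only [zero_smul, one_smul, zero_add, add_zero] at hdet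
  refine ⟨⟨?_, ?_⟩, ⟨?_, ?_⟩, h.mink_frame₄_frame₄ hp, h.mink_frame₃_frame₃ hp, ?_, ?_⟩
  · rw [h.partialS_doubleRotational hp, mink_comm, mink_frame₁_frame₄]
  · rw [h.partialT_doubleRotational hp, mink_smul_right, mink_comm, mink_frame₂_frame₄, mul_zero]
  · rw [h.partialS_doubleRotational hp, mink_comm, mink_frame₁_frame₃]
  · rw [h.partialT_doubleRotational hp, mink_smul_right, mink_comm, mink_frame₂_frame₃, mul_zero]
  · rw [mink_comm, mink_frame₃_frame₄]
  · rw [hdet]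
    simpa using h.speed_pos hp

/-! ### Flat normal bundle -/

lemma tangentPart_eq {p : ℝ × ℝ} (hp : p.1 ∈ I) (v : E41) :
    tangentPart (doubleRotational a b x w) p v =
      (-mink v (frame₁ a b x w p)) • frame₁ a b x w p +
        mink v (frame₂ a b x w p) • frame₂ a b x w p := by
  have hq := (h.speed_pos hp).ne'
  rw [tangentPart, h.metricDet_eq hp, h.metricE_eq hp, h.metricF_eq hp, h.metricG_eq hp,
    h.partialS_doubleRotational hp, h.partialT_doubleRotational hp, mink_smul_right, smul_smul]
  congr 2
  · field_simp
    ring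
  · field_simp
    ring

lemma normalDerivS_frame₃ {p : ℝ × ℝ} (hp : p.1 ∈ I) :
    normalDerivS (doubleRotational a b x w) (frame₃ a b x w) p = 0 := by
  rw [normalDerivS, partialS, (h.hasDerivAt_frame₃_s hp).deriv, normalPart, h.tangentPart_eq hp,
    mink_smul_left, mink_smul_left, h.mink_frame₁_frame₁ hp, mink_frame₁_frame₂]
  simp

lemma normalDerivT_frame₃ {p : ℝ × ℝ} (hp : p.1 ∈ I) :
    normalDerivT (doubleRotational a b x w) (frame₃ a b x w) p =
      torsion a b x w p.1 • frame₄ a b x w p := by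
  rw [normalDerivT, partialT, (h.hasDerivAt_frame₃_t hp).deriv, normalPart, h.tangentPart_eq hp,
    mink_add_left, mink_add_left, mink_smul_left, mink_smul_left, mink_smul_left, mink_smul_left,
    h.mink_frame₂_frame₂ hp, mink_comm _ (frame₁ a b x w p), mink_comm _ (frame₁ a b x w p),
    mink_comm (frame₄ a b x w p), mink_frame₁_frame₂, mink_frame₁_frame₄, mink_frame₂_frame₄]
  simp

lemma mink_normalPart_frame₄ {p : ℝ × ℝ} (hp : p.1 ∈ I) (v : E41) :
    mink (normalPart (doubleRotational a b x w) p v) (frame₄ a b x w p) =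
      mink v (frame₄ a b x w p) := by
  rw [normalPart, h.tangentPart_eq hp, sub_eq_add_neg, ← neg_one_smul ℝ, mink_add_left,
    mink_smul_left, mink_add_left, mink_smul_left, mink_smul_left, mink_frame₁_frame₄,
    mink_frame₂_frame₄]
  simp

/-- Flatness is tested on $\xi=e_3$: $D_se_3=0$ and $D_te_3=\tau e_4$, so the $e_4$ component of
$R^De_3$ is $\tau'$. -/
lemma mixed_mul_curv_sub_rotCurv
    (hflat : HasFlatNormalBundle (doubleRotational a b x w) (paramDomain I)) {s : ℝ}
    (hs : s ∈ I) : mixed a b x w s * (curv x w s - rotCurv a b x w s) = 0 := by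
  have hfst : ∀ {g : ℝ → ℝ}, ContDiffOn ℝ ∞ g I →
      ContDiffOn ℝ ∞ (fun p : ℝ × ℝ => g p.1) (paramDomain I) := fun hg =>
    hg.comp contDiffOn_fst fun p hp => hp.1
  have hsm : ContDiffOn ℝ ∞ (frame₃ a b x w) (paramDomain I) :=
    contDiffOn_rot a b (hfst h.contDiffOn_deriv_w) contDiffOn_const
      (hfst h.contDiffOn_deriv_x) contDiffOn_const
  -- All scalars depend on $s$ alone; $t=\pi$ serves as a sample point of $(0,2\pi)$.
  have hp : (s, Real.pi) ∈ paramDomain I :=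
    ⟨hs, Real.pi_pos, by linarith [Real.pi_pos]⟩
  have key := hflat (frame₃ a b x w) hsm (fun p hp => by
    rw [IsNormalAt, h.partialS_doubleRotational hp.1, h.partialT_doubleRotational hp.1,
      mink_smul_right, mink_comm, mink_comm _ (frame₂ a b x w p), mink_frame₁_frame₃,
      mink_frame₂_frame₃]
    simp) _ hp
  have dS : HasDerivAt (fun s => normalDerivT (doubleRotational a b x w) (frame₃ a b x w)
      (s, Real.pi)) _ s :=
    ((h.hasDerivAt_torsion hs).smul
      (h.hasDerivAt_frame₄_s (p := (s, Real.pi)) hs)).congr_of_eventuallyEq (by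
      filter_upwards [h.isOpen.mem_nhds hs] with z hz using
        h.normalDerivT_frame₃ (p := (z, Real.pi)) hz)
  have dT : HasDerivAt (fun t => normalDerivS (doubleRotational a b x w) (frame₃ a b x w)
      (s, t)) 0 Real.pi :=
    (hasDerivAt_const _ 0).congr_of_eventuallyEq
      (Filter.Eventually.of_forall fun t => h.normalDerivS_frame₃ (p := (s, t)) hs)
  rw [normalCurvature, normalDerivS, normalDerivT, partialS, partialT, dS.deriv, dT.deriv] at key
  have h0 : normalPart (doubleRotational a b x w) (s, Real.pi) 0 = 0 := by
    rw [normalPart, h.tangentPart_eq (p := (s, Real.pi)) hs]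
    simp [mink]
  rw [h0, sub_zero] at key
  have := h.mink_normalPart_frame₄ (p := (s, Real.pi)) hs
    (torsion a b x w s • -mixed a b x w s • frame₂ a b x w (s, Real.pi) +
      (speed a b x w s * mixed a b x w s * (curv x w s - rotCurv a b x w s)) •
        frame₄ a b x w (s, Real.pi))
  rw [key, mink_add_left, mink_smul_left, mink_smul_left, mink_smul_left, mink_frame₂_frame₄,
    h.mink_frame₄_frame₄ (p := (s, Real.pi)) hs] at this
  have hq := (h.speed_pos hs).ne'
  have h0' : mink 0 (frame₄ a b x w (s, Real.pi)) = 0 := by simp [mink]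
  rw [h0'] at this
  apply mul_left_cancel₀ hq
  linear_combination -this

end IsProfile

/-! ### Locality of the Laplacian -/

lemma partialS_congr {V : Type*} [NormedAddCommGroup V] [NormedSpace ℝ V] {φ ψ : ℝ × ℝ → V}
    {U : Set (ℝ × ℝ)} (hU : IsOpen U) (h : Set.EqOn φ ψ U) {p : ℝ × ℝ} (hp : p ∈ U) :
    partialS φ p = partialS ψ p := by
  refine Filter.EventuallyEq.deriv_eq ?_
  have hc : ContinuousAt (fun s : ℝ => (s, p.2)) p.1 := by fun_prop
  filter_upwards [hc.preimage_mem_nhds (hU.mem_nhds hp)] with s hs using h hs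

lemma partialT_congr {V : Type*} [NormedAddCommGroup V] [NormedSpace ℝ V] {φ ψ : ℝ × ℝ → V}
    {U : Set (ℝ × ℝ)} (hU : IsOpen U) (h : Set.EqOn φ ψ U) {p : ℝ × ℝ} (hp : p ∈ U) :
    partialT φ p = partialT ψ p := by
  refine Filter.EventuallyEq.deriv_eq ?_
  have hc : ContinuousAt (fun t : ℝ => (p.1, t)) p.2 := by fun_prop
  filter_upwards [hc.preimage_mem_nhds (hU.mem_nhds hp)] with s hs using h hs

lemma laplacian_congr (r : ℝ × ℝ → E41) {φ ψ : ℝ × ℝ → ℝ} {U : Set (ℝ × ℝ)} (hU : IsOpen U)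
    (h : Set.EqOn φ ψ U) {p : ℝ × ℝ} (hp : p ∈ U) : laplacian r φ p = laplacian r ψ p := by
  rw [laplacian, laplacian]
  congr 2
  · refine partialS_congr hU (fun z hz => ?_) hp
    rw [partialS_congr hU h hz, partialT_congr hU h hz]
  · refine partialT_congr hU (fun z hz => ?_) hp
    rw [partialS_congr hU h hz, partialT_congr hU h hz]

/-! ### The Gauss map equation in the frame and the components of the constant bivector -/

namespace IsProfile
variable {a b : ℝ} {x w : ℝ → ℝ} {I : Set ℝ} (h : IsProfile a b x w I)
include h

lemma isOpen_paramDomain : IsOpen (paramDomain I) := h.isOpen.prod isOpen_Ioo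

/-- The equation `Δ ν = f (ν + C)` in terms of the adapted frame. -/
lemma bivector_equation
    (hflat : HasFlatNormalBundle (doubleRotational a b x w) (paramDomain I))
    {ν : ℝ × ℝ → Bivector} (hν : IsGaussMap (doubleRotational a b x w) (paramDomain I) ν)
    {f : ℝ × ℝ → ℝ} {C : Bivector}
    (heq : GaussMapEquation (doubleRotational a b x w) (paramDomain I) ν f C)
    {p : ℝ × ℝ} (hp : p ∈ paramDomain I) :
    (curv x w p.1 ^ 2 + rotCurv a b x w p.1 ^ 2 - 2 * mixed a b x w p.1 ^ 2) •
        wedge (frame₃ a b x w p) (frame₄ a b x w p) +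
      (deriv (curv x w) p.1 + ((curv x w p.1 - rotCurv a b x w p.1) * speedDeriv a b x w p.1 +
        mixed a b x w p.1 * torsion a b x w p.1) / speed a b x w p.1) •
        wedge (frame₁ a b x w p) (frame₄ a b x w p) +
      ((curv x w p.1 + rotCurv a b x w p.1) * torsion a b x w p.1 / speed a b x w p.1) •
        wedge (frame₂ a b x w p) (frame₃ a b x w p) =
      f p • (wedge (frame₃ a b x w p) (frame₄ a b x w p) - C) := by
  have hform : Set.EqOn ν (fun z => -wedge (frame₃ a b x w z) (frame₄ a b x w z))
      (paramDomain I) := by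
    intro z hz
    obtain ⟨n₁, n₂, hn, hz'⟩ := hν z hz
    rw [hz']
    exact h.wedge_eq_of_isOrientedNormalFrameAt hz.1 hn
  rw [← sub_eq_zero, ← Module.forall_dual_apply_eq_zero_iff ℝ]
  intro ℓ
  have h1 := heq p hp ℓ
  rw [laplacian_congr _ h.isOpen_paramDomain
    (ψ := fun z => wedgeForm (-ℓ) (frame₃ a b x w z) (frame₄ a b x w z))
    (fun z hz => by simp [hform hz]) hp, h.laplacian_form (fun u => by simp [wedge_self]) hp.1,
    hform hp] at h1
  -- Flatness removes the $e_1\wedge e_2$ term of the Laplacian.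
  have h2 := h.mixed_mul_curv_sub_rotCurv hflat hp.1
  simp only [wedgeForm_apply, LinearMap.neg_apply, map_smul, map_add, map_neg, smul_eq_mul] at h1
  simp only [map_sub, map_smul, map_add, smul_eq_mul]
  linear_combination -h1 + 2 * ℓ (wedge (frame₁ a b x w p) (frame₂ a b x w p)) * h2

/-- At a point with `f ≠ 0`, the components of the constant bivector `C` and the relations that
hold because `C` is constant. -/
lemma exists_components
    (hflat : HasFlatNormalBundle (doubleRotational a b x w) (paramDomain I))
    {ν : ℝ × ℝ → Bivector} (hν : IsGaussMap (doubleRotational a b x w) (paramDomain I) ν)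
    {f : ℝ × ℝ → ℝ} (hf : ContDiffOn ℝ ∞ f (paramDomain I)) {C : Bivector} (hC : C ≠ 0)
    (heq : GaussMapEquation (doubleRotational a b x w) (paramDomain I) ν f C)
    {p : ℝ × ℝ} (hp : p ∈ paramDomain I) (hfp : f p ≠ 0) :
    ∃ c₁₄ c₂₃ c₃₄ : ℝ,
      f p * (1 - c₃₄) =
        curv x w p.1 ^ 2 + rotCurv a b x w p.1 ^ 2 - 2 * mixed a b x w p.1 ^ 2 ∧
      f p * c₁₄ = deriv (curv x w) p.1 +
        ((curv x w p.1 - rotCurv a b x w p.1) * speedDeriv a b x w p.1 +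
          mixed a b x w p.1 * torsion a b x w p.1) / speed a b x w p.1 ∧
      f p * c₂₃ =
        -((curv x w p.1 + rotCurv a b x w p.1) * torsion a b x w p.1 / speed a b x w p.1) ∧
      mixed a b x w p.1 * c₁₄ = curv x w p.1 * c₂₃ ∧
      speedDeriv a b x w p.1 * c₂₃ - mixed a b x w p.1 * speed a b x w p.1 * c₃₄ +
        torsion a b x w p.1 * c₁₄ = 0 ∧
      speedDeriv a b x w p.1 * c₁₄ - rotCurv a b x w p.1 * speed a b x w p.1 * c₃₄ -
        torsion a b x w p.1 * c₂₃ = 0 ∧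
      ¬(c₁₄ = 0 ∧ c₂₃ = 0 ∧ c₃₄ = 0) := by
  have hcomp : ∀ z ∈ paramDomain I, f z ≠ 0 →
      pairForm C (frame₁ a b x w z) (frame₂ a b x w z) = 0 ∧
      pairForm C (frame₁ a b x w z) (frame₃ a b x w z) = 0 ∧
      pairForm C (frame₂ a b x w z) (frame₄ a b x w z) = 0 := by
    intro z hz hfz
    have hb := h.bivector_equation hflat hν heq hz
    -- Apart from $fC$, the bivector equation has only 34, 14 and 23 terms, so any pairing that
    -- kills these also kills $C$ when $f\ne0$.
    have key : ∀ u v : E41, pair u v (wedge (frame₃ a b x w z) (frame₄ a b x w z)) = 0 →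
        pair u v (wedge (frame₁ a b x w z) (frame₄ a b x w z)) = 0 →
        pair u v (wedge (frame₂ a b x w z) (frame₃ a b x w z)) = 0 → pair u v C = 0 := by
      intro u v h1 h2 h3
      have := congrArg (pair u v) hb
      simp only [map_add, map_smul, map_sub, h1, h2, h3, smul_eq_mul, mul_zero, zero_sub,
        add_zero] at this
      have := (mul_eq_zero.1 this.symm).resolve_left hfz
      linarith
    refine ⟨key _ _ ?_ ?_ ?_, key _ _ ?_ ?_ ?_, key _ _ ?_ ?_ ?_⟩ <;>
    · rw [pair_wedge]
      simp only [mink_frame₁_frame₂, mink_frame₁_frame₃, mink_frame₁_frame₄, mink_frame₂_frame₃,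
        mink_frame₂_frame₄, mink_frame₃_frame₄, mink_comm (frame₂ a b x w z) (frame₁ a b x w z),
        mink_comm (frame₃ a b x w z) (frame₁ a b x w z),
        mink_comm (frame₃ a b x w z) (frame₂ a b x w z),
        mink_comm (frame₄ a b x w z) (frame₂ a b x w z),
        mink_comm (frame₄ a b x w z) (frame₃ a b x w z)]
      ring
  -- By continuity $f\ne0$ near `p`, so the three pairings vanish on a neighbourhood and their
  -- derivatives vanish at `p`.
  have hnear : ∀ᶠ z in nhds p, z ∈ paramDomain I ∧ f z ≠ 0 :=
    Filter.Eventually.and (h.isOpen_paramDomain.mem_nhds hp)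
      ((hf.continuousOn.continuousAt (h.isOpen_paramDomain.mem_nhds hp)).eventually_ne hfp)
  have hnS : ∀ᶠ s in nhds p.1, (s, p.2) ∈ paramDomain I ∧ f (s, p.2) ≠ 0 :=
    (show ContinuousAt (fun s : ℝ => (s, p.2)) p.1 by fun_prop).eventually hnear
  have hnT : ∀ᶠ t in nhds p.2, (p.1, t) ∈ paramDomain I ∧ f (p.1, t) ≠ 0 :=
    (show ContinuousAt (fun t : ℝ => (p.1, t)) p.2 by fun_prop).eventually hnear
  have hswap := form_swap (pairForm_self C)
  obtain ⟨h12, h13, h24⟩ := hcomp p hp hfp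
  have d12 := (HasDerivAt.form (pairForm C) (h.hasDerivAt_frame₁_s hp.1)
    (h.hasDerivAt_frame₂_s hp.1)).unique
    ((hasDerivAt_const p.1 (0 : ℝ)).congr_of_eventuallyEq (by
      filter_upwards [hnS] with s hs using (hcomp _ hs.1 hs.2).1))
  have d13 := (HasDerivAt.form (pairForm C) (h.hasDerivAt_frame₁_t hp.1)
    (h.hasDerivAt_frame₃_t hp.1)).unique
    ((hasDerivAt_const p.2 (0 : ℝ)).congr_of_eventuallyEq (by
      filter_upwards [hnT] with t ht using (hcomp _ ht.1 ht.2).2.1))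
  have d24 := (HasDerivAt.form (pairForm C) (h.hasDerivAt_frame₂_t hp.1)
    (h.hasDerivAt_frame₄_t hp.1)).unique
    ((hasDerivAt_const p.2 (0 : ℝ)).congr_of_eventuallyEq (by
      filter_upwards [hnT] with t ht using (hcomp _ ht.1 ht.2).2.2))
  simp only [Prod.mk.eta, map_smul, map_add, LinearMap.add_apply, LinearMap.smul_apply,
    smul_eq_mul] at d12 d13 d24
  rw [hswap (frame₂ a b x w p) (frame₃ a b x w p)] at d12
  rw [hswap (frame₃ a b x w p) (frame₄ a b x w p), h12] at d13
  rw [hswap (frame₁ a b x w p) (frame₂ a b x w p), h12] at d24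
  have hb := h.bivector_equation hflat hν heq hp
  have e14 := congrArg (pair (frame₁ a b x w p) (frame₄ a b x w p)) hb
  have e23 := congrArg (pair (frame₂ a b x w p) (frame₃ a b x w p)) hb
  have e34 := congrArg (pair (frame₃ a b x w p) (frame₄ a b x w p)) hb
  simp only [map_add, map_smul, map_sub, pair_wedge, smul_eq_mul, mink_frame₁_frame₂,
    mink_frame₁_frame₃, mink_frame₁_frame₄, mink_frame₂_frame₃, mink_frame₂_frame₄,
    mink_frame₃_frame₄, h.mink_frame₁_frame₁ hp.1, h.mink_frame₂_frame₂ hp.1,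
    h.mink_frame₃_frame₃ hp.1, h.mink_frame₄_frame₄ hp.1,
    mink_comm (frame₂ a b x w p) (frame₁ a b x w p),
    mink_comm (frame₃ a b x w p) (frame₁ a b x w p),
    mink_comm (frame₄ a b x w p) (frame₁ a b x w p),
    mink_comm (frame₃ a b x w p) (frame₂ a b x w p),
    mink_comm (frame₄ a b x w p) (frame₂ a b x w p),
    mink_comm (frame₄ a b x w p) (frame₃ a b x w p)] at e14 e23 e34
  simp only [pairForm_apply] at d12 d13 d24
  refine ⟨pair (frame₁ a b x w p) (frame₄ a b x w p) C,
    pair (frame₂ a b x w p) (frame₃ a b x w p) C,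
    pair (frame₃ a b x w p) (frame₄ a b x w p) C, ?_, ?_, ?_, ?_, ?_, ?_, ?_⟩
  rotate_left 6
  -- If all three pairings vanished, the bivector equation would collapse to $fC=0$.
  · rintro ⟨h14, h23, h34⟩
    apply hC
    rw [h14] at e14
    rw [h23] at e23
    rw [h34] at e34
    have h14' : deriv (curv x w) p.1 + ((curv x w p.1 - rotCurv a b x w p.1) *
        speedDeriv a b x w p.1 + mixed a b x w p.1 * torsion a b x w p.1) /
        speed a b x w p.1 = 0 := by linarith
    have h23' : (curv x w p.1 + rotCurv a b x w p.1) * torsion a b x w p.1 /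
        speed a b x w p.1 = 0 := by linarith
    have h34' : curv x w p.1 ^ 2 + rotCurv a b x w p.1 ^ 2 - 2 * mixed a b x w p.1 ^ 2 = f p := by
      linarith
    rw [h14', h23', h34', zero_smul, zero_smul, add_zero, add_zero, smul_sub, eq_comm,
      sub_eq_self] at hb
    exact (smul_eq_zero.1 hb).resolve_left hfp
  · linear_combination -e34
  · linear_combination e14
  · linear_combination e23
  · linear_combination d12
  · linear_combination d13
  · linear_combination d24

/-- If `f ≠ 0` at a point, then the second fundamental form is diagonal there. -/
lemma mixed_eq_zero_of_ne_zero
    (hflat : HasFlatNormalBundle (doubleRotational a b x w) (paramDomain I))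
    {ν : ℝ × ℝ → Bivector} (hν : IsGaussMap (doubleRotational a b x w) (paramDomain I) ν)
    {f : ℝ × ℝ → ℝ} (hf : ContDiffOn ℝ ∞ f (paramDomain I)) {C : Bivector} (hC : C ≠ 0)
    (heq : GaussMapEquation (doubleRotational a b x w) (paramDomain I) ν f C)
    {p : ℝ × ℝ} (hp : p ∈ paramDomain I) (hfp : f p ≠ 0) : mixed a b x w p.1 = 0 := by
  by_contra hμ
  obtain ⟨c₁₄, c₂₃, c₃₄, -, -, e23, d12, d13, d24, hc⟩ :=
    h.exists_components hflat hν hf hC heq hp hfp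
  have hq := (h.speed_pos hp.1).ne'
  have hκ : curv x w p.1 = rotCurv a b x w p.1 :=
    sub_eq_zero.1 ((mul_eq_zero.1 (h.mixed_mul_curv_sub_rotCurv hflat hp.1)).resolve_left hμ)
  rw [hκ] at d12 e23
  have hc23 : c₂₃ = 0 := by
    by_cases hτ : torsion a b x w p.1 = 0
    · rw [hτ] at e23
      simpa [hfp] using e23
    -- Eliminating $c_{34}$ and then $c_{14}$ from the three linear relations, with
    -- $\kappa=\lambda$.
    · have : torsion a b x w p.1 * c₂₃ *
          (rotCurv a b x w p.1 ^ 2 + mixed a b x w p.1 ^ 2) = 0 := by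
        linear_combination mixed a b x w p.1 * rotCurv a b x w p.1 * d13 -
          mixed a b x w p.1 ^ 2 * d24 + (mixed a b x w p.1 * speedDeriv a b x w p.1 -
            rotCurv a b x w p.1 * torsion a b x w p.1) * d12
      have hpos : rotCurv a b x w p.1 ^ 2 + mixed a b x w p.1 ^ 2 ≠ 0 := by positivity
      simpa [hτ, hpos] using this
  have hc14 : c₁₄ = 0 := by
    rw [hc23, mul_zero] at d12
    exact (mul_eq_zero.1 d12).resolve_left hμ
  have hc34 : c₃₄ = 0 := by
    rw [hc23, hc14] at d13
    simpa [hμ, hq] using d13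
  exact hc ⟨hc14, hc23, hc34⟩

end IsProfile

/-! ### From the second kind condition to a degenerate profile curve -/

lemma eq_of_hasDerivAt_zero {I : Set ℝ} (hI : IsOpen I) (hIc : I.OrdConnected) {g : ℝ → ℝ}
    (hg : ∀ s ∈ I, HasDerivAt g 0 s) {s t : ℝ} (hs : s ∈ I) (ht : t ∈ I) : g s = g t :=
  hI.is_const_of_deriv_eq_zero hIc.isPreconnected
    (fun z hz => (hg z hz).differentiableAt.differentiableWithinAt)
    (fun z hz => (hg z hz).deriv) hs ht

namespace IsProfile
variable {a b : ℝ} {x w : ℝ → ℝ} {I : Set ℝ} (h : IsProfile a b x w I)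
include h

lemma deriv_w_ne_zero {s : ℝ} (hs : s ∈ I) : deriv w s ≠ 0 := by
  intro h0
  have := h.arc s hs
  rw [h0] at this
  nlinarith [sq_nonneg (deriv x s)]

lemma mixed_eq_zero_iff (ha : a ≠ 0) (hb : b ≠ 0) {s : ℝ} (hs : s ∈ I) :
    mixed a b x w s = 0 ↔ deriv x s * w s = x s * deriv w s := by
  simp [mixed, ha, hb, (h.speed_pos hs).ne', sub_eq_zero]

lemma torsion_eq_zero_iff (ha : a ≠ 0) (hb : b ≠ 0) {s : ℝ} (hs : s ∈ I) :
    torsion a b x w s = 0 ↔ w s * deriv w s = x s * deriv x s := by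
  simp [torsion, ha, hb, (h.speed_pos hs).ne', sub_eq_zero]

lemma rotCurv_eq_zero_iff {s : ℝ} (hs : s ∈ I) :
    rotCurv a b x w s = 0 ↔ a ^ 2 * x s * deriv w s + b ^ 2 * w s * deriv x s = 0 := by
  simp [rotCurv, (h.speed_pos hs).ne']

lemma speedDeriv_eq_zero_iff {s : ℝ} (hs : s ∈ I) :
    speedDeriv a b x w s = 0 ↔ a ^ 2 * x s * deriv x s + b ^ 2 * w s * deriv w s = 0 := by
  simp [speedDeriv, (h.speed_pos hs).ne']

lemma x_eq_zero_of_mixed_of_rotCurv (ha : a ≠ 0) (hb : b ≠ 0) {s : ℝ} (hs : s ∈ I)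
    (hμ : mixed a b x w s = 0) (hl : rotCurv a b x w s = 0) : x s = 0 := by
  rw [h.mixed_eq_zero_iff ha hb hs] at hμ
  rw [h.rotCurv_eq_zero_iff hs] at hl
  have h0 : (a ^ 2 + b ^ 2) * deriv w s * x s = 0 := by
    linear_combination hl - b ^ 2 * hμ
  have h1 : a ^ 2 + b ^ 2 ≠ 0 := by positivity
  exact (mul_eq_zero.1 h0).resolve_left (mul_ne_zero h1 (h.deriv_w_ne_zero hs))

/-- When $\mu=0$ the vectors $(x,w)$ and $(x',w')$ are parallel and nonzero, so the definite form
$a^2xx'+b^2ww'=qq'$ cannot vanish on them. -/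
lemma speedDeriv_ne_zero_of_mixed (ha : a ≠ 0) (hb : b ≠ 0) {s : ℝ} (hs : s ∈ I)
    (hμ : mixed a b x w s = 0) : speedDeriv a b x w s ≠ 0 := by
  intro hq
  rw [h.mixed_eq_zero_iff ha hb hs] at hμ
  rw [h.speedDeriv_eq_zero_iff hs] at hq
  have hw' := h.deriv_w_ne_zero hs
  have h0 : (a ^ 2 * deriv x s ^ 2 + b ^ 2 * deriv w s ^ 2) * w s = 0 := by
    linear_combination deriv w s * hq + a ^ 2 * deriv x s * hμ
  have h1 : a ^ 2 * deriv x s ^ 2 + b ^ 2 * deriv w s ^ 2 ≠ 0 := by positivity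
  have hw : w s = 0 := (mul_eq_zero.1 h0).resolve_left h1
  have hx : x s = 0 := by
    rw [hw, mul_zero, eq_comm] at hμ
    exact (mul_eq_zero.1 hμ).resolve_right hw'
  have := h.pos s hs
  simp [hx, hw] at this

lemma components_of_eq_zero
    (hflat : HasFlatNormalBundle (doubleRotational a b x w) (paramDomain I))
    {ν : ℝ × ℝ → Bivector} (hν : IsGaussMap (doubleRotational a b x w) (paramDomain I) ν)
    {f : ℝ × ℝ → ℝ} {C : Bivector}
    (heq : GaussMapEquation (doubleRotational a b x w) (paramDomain I) ν f C)
    {p : ℝ × ℝ} (hp : p ∈ paramDomain I) (hfp : f p = 0) :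
    curv x w p.1 ^ 2 + rotCurv a b x w p.1 ^ 2 - 2 * mixed a b x w p.1 ^ 2 = 0 ∧
      (curv x w p.1 + rotCurv a b x w p.1) * torsion a b x w p.1 = 0 := by
  have hb := h.bivector_equation hflat hν heq hp
  have hq := (h.speed_pos hp.1).ne'
  have e23 := congrArg (pair (frame₂ a b x w p) (frame₃ a b x w p)) hb
  have e34 := congrArg (pair (frame₃ a b x w p) (frame₄ a b x w p)) hb
  simp only [map_add, map_smul, map_sub, pair_wedge, smul_eq_mul, mink_frame₁_frame₂,
    mink_frame₁_frame₃, mink_frame₁_frame₄, mink_frame₂_frame₃, mink_frame₂_frame₄,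
    mink_frame₃_frame₄, h.mink_frame₂_frame₂ hp.1,
    h.mink_frame₃_frame₃ hp.1, h.mink_frame₄_frame₄ hp.1, hfp,
    mink_comm (frame₂ a b x w p) (frame₁ a b x w p),
    mink_comm (frame₃ a b x w p) (frame₁ a b x w p),
    mink_comm (frame₄ a b x w p) (frame₁ a b x w p),
    mink_comm (frame₃ a b x w p) (frame₂ a b x w p),
    mink_comm (frame₄ a b x w p) (frame₂ a b x w p),
    mink_comm (frame₄ a b x w p) (frame₃ a b x w p)] at e23 e34
  refine ⟨by linear_combination e34, ?_⟩
  have : (curv x w p.1 + rotCurv a b x w p.1) * torsion a b x w p.1 / speed a b x w p.1 = 0 := by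
    linear_combination e23
  simpa [hq] using this

/-- By flatness τ is constant, so one zero gives $ww'=xx'$ on all of `I`. Then $P=xw'-wx'$ is a
nonzero constant with $\kappa P=1$, and this rigidity is incompatible with $\Delta\nu=0$. -/
lemma torsion_ne_zero (ha : a ≠ 0) (hb : b ≠ 0) (hIc : I.OrdConnected)
    (hflat : HasFlatNormalBundle (doubleRotational a b x w) (paramDomain I))
    {ν : ℝ × ℝ → Bivector} (hν : IsGaussMap (doubleRotational a b x w) (paramDomain I) ν)
    {f : ℝ × ℝ → ℝ} (hf : ContDiffOn ℝ ∞ f (paramDomain I)) {C : Bivector} (hC : C ≠ 0)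
    (heq : GaussMapEquation (doubleRotational a b x w) (paramDomain I) ν f C)
    {s : ℝ} (hs : s ∈ I) : torsion a b x w s ≠ 0 := by
  intro hτs
  have hτ : ∀ z ∈ I, w z * deriv w z = x z * deriv x z := by
    intro z hz
    rw [← h.torsion_eq_zero_iff ha hb hz, ← hτs]
    refine eq_of_hasDerivAt_zero h.isOpen hIc (fun y hy => ?_) hz hs
    refine (h.hasDerivAt_torsion hy).congr_deriv ?_
    rw [mul_assoc, h.mixed_mul_curv_sub_rotCurv hflat hy, mul_zero]
  have hκ : ∀ z ∈ I, curv x w z * (x z * deriv w z - w z * deriv x z) = 1 := by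
    intro z hz
    have d := (((h.hasDerivAt_w hz).mul (h.hasDerivAt_deriv_w hz)).sub
      ((h.hasDerivAt_x hz).mul (h.hasDerivAt_deriv_x hz))).unique
      ((hasDerivAt_const z (0 : ℝ)).congr_of_eventuallyEq (by
        filter_upwards [h.isOpen.mem_nhds hz] with y hy using sub_eq_zero.2 (hτ y hy)))
    linear_combination -d - h.arc z hz
  have hP : ∀ z ∈ I, x z * deriv w z - w z * deriv x z = x s * deriv w s - w s * deriv x s := by
    intro z hz
    refine eq_of_hasDerivAt_zero (g := fun z => x z * deriv w z - w z * deriv x z)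
      h.isOpen hIc (fun y hy => ?_) hz hs
    refine (((h.hasDerivAt_x hy).mul (h.hasDerivAt_deriv_w hy)).sub
      ((h.hasDerivAt_w hy).mul (h.hasDerivAt_deriv_x hy))).congr_deriv ?_
    linear_combination -curv x w y * hτ y hy
  -- Since $P\ne0$, μ has no zero; hence $f=0$ and $\kappa=\lambda$, and the 34 component gives
  -- $\kappa^2=\mu^2$. Inserting $\kappa=1/P$ and $\mu=-abP/q^2$ shows that $q^4$ is constant.
  have hq : ∀ z ∈ I, speed a b x w z ^ 4 =
      a ^ 2 * b ^ 2 * (x s * deriv w s - w s * deriv x s) ^ 4 := by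
    intro z hz
    have hq0 := (h.speed_pos hz).ne'
    have hpz : (z, Real.pi) ∈ paramDomain I := ⟨hz, Real.pi_pos, by linarith [Real.pi_pos]⟩
    have hμ : mixed a b x w z ≠ 0 := by
      intro h0
      rw [h.mixed_eq_zero_iff ha hb hz] at h0
      have := hκ z hz
      rw [← h0] at this
      simp [mul_comm] at this
    have hf0 : f (z, Real.pi) = 0 := by
      by_contra hf0
      exact hμ (h.mixed_eq_zero_of_ne_zero hflat hν hf hC heq hpz hf0)
    have hl : curv x w z = rotCurv a b x w z :=
      sub_eq_zero.1 ((mul_eq_zero.1 (h.mixed_mul_curv_sub_rotCurv hflat hz)).resolve_left hμ)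
    have hA := (h.components_of_eq_zero hflat hν heq hpz hf0).1
    simp only [← hl] at hA
    have hm : mixed a b x w z * speed a b x w z ^ 2 =
        -(a * b * (x z * deriv w z - w z * deriv x z)) := by
      simp only [mixed]
      field_simp
      ring
    rw [← hP z hz]
    have hκz := hκ z hz
    set P := x z * deriv w z - w z * deriv x z
    linear_combination (P ^ 2 * speed a b x w z ^ 4 / 2) * hA +
      P ^ 2 * (mixed a b x w z * speed a b x w z ^ 2 - a * b * P) * hm -
      speed a b x w z ^ 4 * (curv x w z * P + 1) * hκz
  -- Now $q'=0$, and $a^2xx'+b^2ww'=0$ together with $xx'=ww'$ gives $(a^2+b^2)ww'=0$.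
  have hww : ∀ z ∈ I, w z = 0 := by
    intro z hz
    have hq0 := (h.speed_pos hz).ne'
    have d := ((h.hasDerivAt_speed hz).pow 4).unique
      ((hasDerivAt_const z _).congr_of_eventuallyEq (by
        filter_upwards [h.isOpen.mem_nhds hz] with y hy using hq y hy))
    have hq1 : speedDeriv a b x w z = 0 := by simpa [hq0] using d
    rw [h.speedDeriv_eq_zero_iff hz] at hq1
    have h0 : (a ^ 2 + b ^ 2) * deriv w z * w z = 0 := by
      linear_combination hq1 + a ^ 2 * hτ z hz
    have h1 : a ^ 2 + b ^ 2 ≠ 0 := by positivity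
    exact (mul_eq_zero.1 h0).resolve_left (mul_ne_zero h1 (h.deriv_w_ne_zero hz))
  refine h.deriv_w_ne_zero hs ((h.hasDerivAt_w hs).unique
    ((hasDerivAt_const s (0 : ℝ)).congr_of_eventuallyEq ?_))
  filter_upwards [h.isOpen.mem_nhds hs] with y hy using hww y hy

/-- A double rotational surface with flat normal bundle and pointwise 1-type Gauss map of the
second kind has a degenerate profile curve. -/
lemma x_eq_zero_of_secondKind (ha : a ≠ 0) (hb : b ≠ 0) (hIc : I.OrdConnected)
    (hflat : HasFlatNormalBundle (doubleRotational a b x w) (paramDomain I))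
    (hG : HasPointwiseOneTypeGaussMapSecondKind (doubleRotational a b x w) (paramDomain I))
    {s : ℝ} (hs : s ∈ I) : x s = 0 := by
  obtain ⟨ν, hν, f, hf, C, hC, heq⟩ := hG
  have hτ : ∀ z ∈ I, torsion a b x w z ≠ 0 := fun z hz =>
    h.torsion_ne_zero ha hb hIc hflat hν hf hC heq hz
  have hmem : ∀ z ∈ I, (z, Real.pi) ∈ paramDomain I := fun z hz =>
    ⟨hz, Real.pi_pos, by linarith [Real.pi_pos]⟩
  have hμ : ∀ z ∈ I, mixed a b x w z = 0 := by
    intro z hz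
    by_cases hf0 : f (z, Real.pi) = 0
    · obtain ⟨hA, hD⟩ := h.components_of_eq_zero hflat hν heq (hmem z hz) hf0
      have hκ : curv x w z + rotCurv a b x w z = 0 := (mul_eq_zero.1 hD).resolve_right (hτ z hz)
      have hm := h.mixed_mul_curv_sub_rotCurv hflat hz
      -- With $\lambda=-\kappa$ one has $\kappa^2=\mu^2$ from the 34 component and $\mu\kappa=0$
      -- from flatness.
      have : mixed a b x w z ^ 3 = 0 := by
        simp only at hA
        linear_combination (-mixed a b x w z / 2) * hA + (mixed a b x w z / 4) *
          (curv x w z + rotCurv a b x w z) * hκ + (curv x w z - rotCurv a b x w z) / 4 * hm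
      exact pow_eq_zero_iff (by norm_num) |>.1 this
    · exact h.mixed_eq_zero_of_ne_zero hflat hν hf hC heq (hmem z hz) hf0
  have hκ : ∀ z ∈ I, curv x w z = 0 := by
    intro z hz
    have hq := (h.speed_pos hz).ne'
    have d := (h.hasDerivAt_mixed hz).unique
      ((hasDerivAt_const z (0 : ℝ)).congr_of_eventuallyEq (by
        filter_upwards [h.isOpen.mem_nhds hz] with y hy using hμ y hy))
    rw [hμ z hz] at d
    simpa [hq, hτ z hz] using d
  have hκ' : deriv (curv x w) s = 0 :=
    ((hasDerivAt_const s (0 : ℝ)).congr_of_eventuallyEq (by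
        filter_upwards [h.isOpen.mem_nhds hs] with y hy using hκ y hy)).deriv
  have hq := (h.speed_pos hs).ne'
  refine h.x_eq_zero_of_mixed_of_rotCurv ha hb hs (hμ s hs) ?_
  by_cases hf0 : f (s, Real.pi) = 0
  · obtain ⟨-, hD⟩ := h.components_of_eq_zero hflat hν heq (hmem s hs) hf0
    simpa [hκ s hs, hτ s hs] using hD
  · obtain ⟨c₁₄, c₂₃, c₃₄, -, e14, e23, -, d13, -, -⟩ :=
      h.exists_components hflat hν hf hC heq (hmem s hs) hf0
    simp only [hκ s hs, hκ', hμ s hs] at e14 e23 d13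
    have hq1 := h.speedDeriv_ne_zero_of_mixed ha hb hs (hμ s hs)
    field_simp at e14 e23
    -- With $\kappa=\mu=0$ the relations read $fc_{14}=-\lambda q'/q$, $fc_{23}=-\lambda\tau/q$ and
    -- $q'c_{23}+\tau c_{14}=0$, whence $\lambda q'\tau=0$.
    have : rotCurv a b x w s * (speedDeriv a b x w s * torsion a b x w s) = 0 := by
      linear_combination (-f (s, Real.pi) * speed a b x w s / 2) * d13 +
        speedDeriv a b x w s / 2 * e23 + torsion a b x w s / 2 * e14
    exact (mul_eq_zero.1 this).resolve_right (mul_ne_zero hq1 (hτ s hs))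

end IsProfile

/-! ### Planar surfaces and the converse -/

lemma mem_direction_of_hasDerivAt {P : AffineSubspace ℝ E41} {g : ℝ → E41} {g' : E41} {t : ℝ}
    (hg : HasDerivAt g g' t) (hP : ∀ᶠ s in nhds t, g s ∈ P) : g' ∈ P.direction := by
  have hcl : IsClosed (P.direction : Set E41) := P.direction.closed_of_finiteDimensional
  refine hcl.mem_of_tendsto (hasDerivAt_iff_tendsto_slope.1 hg) ?_
  filter_upwards [nhdsWithin_le_nhds hP] with s hs
  exact P.direction.smul_mem _ (AffineSubspace.vsub_mem_direction hs hP.self_of_nhds)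

lemma mem_of_hasDerivAt {D : Submodule ℝ E41} {g : ℝ → E41} {g' : E41} {t : ℝ}
    (hg : HasDerivAt g g' t) (hD : ∀ᶠ s in nhds t, g s ∈ D) : g' ∈ D := by
  have := mem_direction_of_hasDerivAt (P := D.toAffineSubspace) hg
    (by simpa using hD)
  simpa using this

/-- Pairwise orthogonal non-null vectors are linearly independent even for an indefinite form. -/
lemma three_le_finrank {D : Submodule ℝ E41} {v : Fin 3 → E41} (hv : ∀ i, v i ∈ D)
    (hne : ∀ i, mink (v i) (v i) ≠ 0) (ho : ∀ i j, i ≠ j → mink (v i) (v j) = 0) :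
    3 ≤ Module.finrank ℝ D := by
  have hli : LinearIndependent ℝ v := by
    rw [Fintype.linearIndependent_iff]
    intro g hg i
    have h1 := congrArg (minkL (v i)) hg
    simp only [map_sum, map_smul, map_zero, minkL_apply, smul_eq_mul] at h1
    rw [Finset.sum_eq_single i (fun j _ hj => by rw [ho i j hj.symm, mul_zero]) (by simp)] at h1
    exact (mul_eq_zero.1 h1).resolve_right (hne i)
  have hle : Submodule.span ℝ (Set.range v) ≤ D := by
    rw [Submodule.span_le]
    rintro _ ⟨i, rfl⟩
    exact hv i
  have := Submodule.finrank_mono hle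
  rwa [finrank_span_eq_card hli, Fintype.card_fin] at this

namespace IsProfile
variable {a b : ℝ} {x w : ℝ → ℝ} {I : Set ℝ} (h : IsProfile a b x w I)
include h

/-- The derivatives of $e_2$ stay in the direction of the plane. A nonzero μ or λ would place a unit
normal there beside $e_1$ and $e_2$, exceeding dimension 2. -/
lemma mixed_rotCurv_eq_zero_of_plane {P : AffineSubspace ℝ E41}
    (hP : Module.finrank ℝ P.direction = 2)
    (hsub : doubleRotational a b x w '' paramDomain I ⊆ P) {s : ℝ} (hs : s ∈ I) :
    mixed a b x w s = 0 ∧ rotCurv a b x w s = 0 := by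
  have hU : IsOpen (paramDomain I) := h.isOpen.prod isOpen_Ioo
  have hnS : ∀ p ∈ paramDomain I, ∀ᶠ s in nhds p.1, (s, p.2) ∈ paramDomain I := fun p hp =>
    (show ContinuousAt (fun s : ℝ => (s, p.2)) p.1 by fun_prop).eventually (hU.mem_nhds hp)
  have hnT : ∀ p ∈ paramDomain I, ∀ᶠ t in nhds p.2, (p.1, t) ∈ paramDomain I := fun p hp =>
    (show ContinuousAt (fun t : ℝ => (p.1, t)) p.2 by fun_prop).eventually (hU.mem_nhds hp)
  have h1 : ∀ p ∈ paramDomain I, frame₁ a b x w p ∈ P.direction := by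
    intro p hp
    have d := hasDerivAt_rot_coeff a b p.2 (h.hasDerivAt_x hp.1) (hasDerivAt_const _ 0)
      (h.hasDerivAt_w hp.1) (hasDerivAt_const _ 0)
    refine mem_direction_of_hasDerivAt d ?_
    filter_upwards [hnS p hp] with z hz
    rw [← doubleRotational_eq_rot a b x w (z, p.2)]
    exact hsub ⟨_, hz, rfl⟩
  have h2 : ∀ p ∈ paramDomain I, frame₂ a b x w p ∈ P.direction := by
    intro p hp
    have hq := (h.speed_pos hp.1).ne'
    rw [← P.direction.smul_mem_iff hq]
    rw [← h.partialT_doubleRotational hp.1, partialT]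
    simp only [doubleRotational_eq_rot]
    rw [(hasDerivAt_rot a b p.2 (x p.1) 0 (w p.1) 0).deriv]
    refine mem_direction_of_hasDerivAt (hasDerivAt_rot a b p.2 (x p.1) 0 (w p.1) 0) ?_
    filter_upwards [hnT p hp] with z hz
    rw [← doubleRotational_eq_rot a b x w (p.1, z)]
    exact hsub ⟨_, hz, rfl⟩
  have hp : (s, Real.pi) ∈ paramDomain I := ⟨hs, Real.pi_pos, by linarith [Real.pi_pos]⟩
  have hq := (h.speed_pos hs).ne'
  have e1 := h1 _ hp
  have e2 := h2 _ hp
  have key : ∀ n : E41, n ∈ P.direction → mink n n = 1 →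
      mink (frame₁ a b x w (s, Real.pi)) n = 0 →
      mink (frame₂ a b x w (s, Real.pi)) n = 0 → False := by
    intro n hn hnn hn1 hn2
    have := three_le_finrank (D := P.direction)
      (v := ![frame₁ a b x w (s, Real.pi), frame₂ a b x w (s, Real.pi), n])
      (by intro i; fin_cases i <;> assumption)
      (by
        intro i
        fin_cases i
        · simp [h.mink_frame₁_frame₁ (p := (s, Real.pi)) hs]
        · simp [h.mink_frame₂_frame₂ (p := (s, Real.pi)) hs]
        · simp [hnn])
      (by
        intro i j hij
        fin_cases i <;> fin_cases j <;>
          first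
          | exact absurd rfl hij
          | simp [hn1, hn2, mink_frame₁_frame₂, mink_comm n,
              mink_comm (frame₂ a b x w (s, Real.pi)) (frame₁ a b x w (s, Real.pi))])
    exact absurd (this.trans_eq hP) (by norm_num)
  constructor
  · by_contra hμ
    have d := mem_of_hasDerivAt (h.hasDerivAt_frame₂_s (p := (s, Real.pi)) hs)
      ((hnS _ hp).mono fun z hz => h2 _ hz)
    rw [P.direction.smul_mem_iff hμ] at d
    exact key _ d (h.mink_frame₄_frame₄ (p := (s, Real.pi)) hs) (mink_frame₁_frame₄ _)
      (mink_frame₂_frame₄ _)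
  · by_contra hl
    have d := mem_of_hasDerivAt (h.hasDerivAt_frame₂_t (p := (s, Real.pi)) hs)
      ((hnT _ hp).mono fun z hz => h2 _ hz)
    rw [P.direction.add_mem_iff_right (P.direction.smul_mem _ e1),
      P.direction.smul_mem_iff (mul_ne_zero (neg_ne_zero.2 hl) hq)] at d
    exact key _ d (h.mink_frame₃_frame₃ (p := (s, Real.pi)) hs) (mink_frame₁_frame₃ _)
      (mink_frame₂_frame₃ _)

lemma curv_mixed_rotCurv_eq_zero (hx : ∀ s ∈ I, x s = 0) {s : ℝ} (hs : s ∈ I) :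
    curv x w s = 0 ∧ mixed a b x w s = 0 ∧ rotCurv a b x w s = 0 := by
  have hx' : ∀ z ∈ I, deriv x z = 0 := by
    intro z hz
    refine ((hasDerivAt_const z (0 : ℝ)).congr_of_eventuallyEq ?_).deriv
    filter_upwards [h.isOpen.mem_nhds hz] with y hy using hx y hy
  have hx'' : deriv (deriv x) s = 0 := by
    refine ((hasDerivAt_const s (0 : ℝ)).congr_of_eventuallyEq ?_).deriv
    filter_upwards [h.isOpen.mem_nhds hs] with y hy using hx' y hy
  simp [curv, mixed, rotCurv, hx s hs, hx' s hs, hx'']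

lemma secondKind_of_x_eq_zero (hx : ∀ s ∈ I, x s = 0) :
    HasPointwiseOneTypeGaussMapSecondKind (doubleRotational a b x w) (paramDomain I) := by
  refine ⟨fun z => wedge (frame₄ a b x w z) (frame₃ a b x w z), fun p hp =>
    ⟨_, _, h.isOrientedNormalFrameAt hp.1, rfl⟩, fun _ => 0, contDiffOn_const,
    -- With $f=0$ any nonzero bivector serves as $C$; this one pairs to 1 with itself.
    wedge (Pi.single 0 1) (Pi.single 1 1), ?_, ?_⟩
  · intro h0
    have := congrArg (pair (Pi.single 0 1) (Pi.single 1 1)) h0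
    rw [pair_wedge, map_zero] at this
    simp [mink] at this
  · intro p hp ℓ
    have hform := h.laplacian_form (W := wedgeForm (-ℓ)) (fun u => by simp [wedge_self]) hp.1
    obtain ⟨hκ, hμ, hl⟩ := h.curv_mixed_rotCurv_eq_zero hx hp.1
    have hκ' : deriv (curv x w) p.1 = 0 :=
      ((hasDerivAt_const p.1 (0 : ℝ)).congr_of_eventuallyEq (by
        filter_upwards [h.isOpen.mem_nhds hp.1] with y hy using
          (h.curv_mixed_rotCurv_eq_zero hx hy).1)).deriv
    rw [hκ, hμ, hl, hκ'] at hform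
    have hfun : (fun z => ℓ (wedge (frame₄ a b x w z) (frame₃ a b x w z))) =
        fun z => wedgeForm (-ℓ) (frame₃ a b x w z) (frame₄ a b x w z) := by
      funext z
      rw [wedge_swap (frame₃ a b x w z) (frame₄ a b x w z)]
      simp
    rw [hfun, hform]
    simp

/-- The Jacobian is $-bww'\ne0$, so the map is open at each point by the surjective form of the
inverse function theorem. -/
lemma isOpen_image_hyperbolic (hb : b ≠ 0) (hw0 : ∀ s ∈ I, w s ≠ 0)
    (hw1 : ∀ s ∈ I, deriv w s ≠ 0) :
    IsOpen ((fun p : ℝ × ℝ => (w p.1 * Real.sinh (b * p.2), w p.1 * Real.cosh (b * p.2))) ''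
      paramDomain I) := by
  have hU : IsOpen (paramDomain I) := h.isOpen.prod isOpen_Ioo
  rw [isOpen_iff_mem_nhds]
  rintro _ ⟨p, hp, rfl⟩
  set F : ℝ × ℝ → ℝ × ℝ :=
    fun p => (w p.1 * Real.sinh (b * p.2), w p.1 * Real.cosh (b * p.2))
  have hwc : ContDiffAt ℝ ∞ (fun p : ℝ × ℝ => w p.1) p :=
    (h.contDiffOn_w.contDiffAt (h.isOpen.mem_nhds hp.1)).comp p contDiffAt_fst
  have hFc : ContDiffAt ℝ ∞ F p := by
    have hsinh : ContDiffAt ℝ ∞ (fun p : ℝ × ℝ => Real.sinh (b * p.2)) p := by fun_prop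
    have hcosh : ContDiffAt ℝ ∞ (fun p : ℝ × ℝ => Real.cosh (b * p.2)) p := by fun_prop
    exact (hwc.mul hsinh).prodMk (hwc.mul hcosh)
  have hFd := hFc.hasStrictFDerivAt (by simp)
  have hs : HasDerivAt (fun s => F (s, p.2))
      (deriv w p.1 * Real.sinh (b * p.2), deriv w p.1 * Real.cosh (b * p.2)) p.1 :=
    ((h.hasDerivAt_w hp.1).mul_const (Real.sinh (b * p.2))).prodMk
      ((h.hasDerivAt_w hp.1).mul_const (Real.cosh (b * p.2)))
  have hbt : HasDerivAt (fun t => b * t) b p.2 := by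
    simpa using (hasDerivAt_id p.2).const_mul b
  have ht : HasDerivAt (fun t => F (p.1, t))
      (w p.1 * (Real.cosh (b * p.2) * b), w p.1 * (Real.sinh (b * p.2) * b)) p.2 :=
    (hbt.sinh.const_mul (w p.1)).prodMk (hbt.cosh.const_mul (w p.1))
  have cs : HasDerivAt (F ∘ fun s => (s, p.2)) (fderiv ℝ F p (1, 0)) p.1 :=
    hFd.hasFDerivAt.comp_hasDerivAt (f := fun s => (s, p.2)) p.1
      ((hasDerivAt_id p.1).prodMk (hasDerivAt_const p.1 p.2))
  have ct : HasDerivAt (F ∘ fun t => (p.1, t)) (fderiv ℝ F p (0, 1)) p.2 :=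
    hFd.hasFDerivAt.comp_hasDerivAt (f := fun t => (p.1, t)) p.2
      ((hasDerivAt_const p.2 p.1).prodMk (hasDerivAt_id p.2))
  have hs' := cs.unique hs
  have ht' := ct.unique ht
  have hsurj : (fderiv ℝ F p).range = ⊤ := by
    rw [LinearMap.range_eq_top]
    rintro ⟨y, v⟩
    have h1 := hw0 _ hp.1
    have h2 := hw1 _ hp.1
    have h3 := Real.cosh_sq (b * p.2)
    -- Cramer's rule for the Jacobian matrix, using $\cosh^2-\sinh^2=1$.
    refine ⟨((v * Real.cosh (b * p.2) - y * Real.sinh (b * p.2)) / deriv w p.1) • (1, 0) +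
      ((y * Real.cosh (b * p.2) - v * Real.sinh (b * p.2)) / (b * w p.1)) • (0, 1), ?_⟩
    rw [ContinuousLinearMap.coe_coe, map_add, map_smul, map_smul, hs', ht']
    ext
    · simp
      field_simp
      linear_combination y * h3
    · simp
      field_simp
      linear_combination v * h3
  rw [← hFd.map_nhds_eq_of_surj hsurj]
  exact Filter.image_mem_map (hU.mem_nhds hp)

lemma isOpenPart_of_x_eq_zero (hb : b ≠ 0) (hx : ∀ s ∈ I, x s = 0) :
    IsOpenPartOfTimelikePlane (doubleRotational a b x w) (paramDomain I) := by
  have hw0 : ∀ s ∈ I, w s ≠ 0 := by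
    intro s hs h0
    have := h.pos s hs
    simp [hx s hs, h0] at this
  have hw1 : ∀ s ∈ I, deriv w s ≠ 0 := by
    intro s hs h0
    have := h.arc s hs
    rw [h0] at this
    nlinarith [sq_nonneg (deriv x s)]
  let L : ℝ × ℝ →ₗ[ℝ] E41 :=
    { toFun := fun q => ![0, 0, q.1, q.2]
      map_add' := fun q q' => by ext i; fin_cases i <;> simp
      map_smul' := fun c q => by ext i; fin_cases i <;> simp }
  have hr : ∀ p ∈ paramDomain I, doubleRotational a b x w p =
      L (w p.1 * Real.sinh (b * p.2), w p.1 * Real.cosh (b * p.2)) := by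
    intro p hp
    simp [doubleRotational, L, hx _ hp.1]
  have hL : Function.Injective L := by
    intro q q' hqq
    exact Prod.ext (congrFun hqq 2) (congrFun hqq 3)
  refine ⟨L.range.toAffineSubspace, ⟨?_, ?_⟩, ?_, ?_⟩
  · rw [Submodule.toAffineSubspace_direction, LinearMap.finrank_range_of_inj hL]
    simp
  · refine ⟨L (0, 1), by simp, ?_⟩
    simp [L, mink]
  · rintro _ ⟨p, hp, rfl⟩
    rw [hr p hp]
    simp
  -- Inside the plane, the last two coordinates identify the surface with the hyperbolic image.
  · have hc : Continuous fun z : L.range.toAffineSubspace => ((z : E41) 2, (z : E41) 3) :=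
      ((continuous_apply 2).comp continuous_subtype_val).prodMk
        ((continuous_apply 3).comp continuous_subtype_val)
    convert (h.isOpen_image_hyperbolic hb hw0 hw1).preimage hc using 1
    ext ⟨z, hz⟩
    obtain ⟨q, rfl⟩ : ∃ q, L q = z := by simpa using hz
    constructor
    · rintro ⟨p, hp, hpz⟩
      refine ⟨p, hp, hL ?_⟩
      rw [← hr p hp, hpz]
      rfl
    · rintro ⟨p, hp, hpz⟩
      refine ⟨p, hp, ?_⟩
      rw [hr p hp]
      exact congrArg L hpz

end IsProfile

/-! ### Regularity of the profile and conclusion -/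

lemma pos_of_isTimelikeSurface {a b : ℝ} {x w : ℝ → ℝ} {I : Set ℝ} (ha : a ≠ 0) (hb : b ≠ 0)
    (hM : IsTimelikeSurface (doubleRotational a b x w) (paramDomain I)) {s : ℝ} (hs : s ∈ I) :
    0 < a ^ 2 * x s ^ 2 + b ^ 2 * w s ^ 2 := by
  by_contra hn
  have hx0 : 0 ≤ a ^ 2 * x s ^ 2 := by positivity
  have hw0 : 0 ≤ b ^ 2 * w s ^ 2 := by positivity
  have h1 : a ^ 2 * x s ^ 2 = 0 := by linarith
  have h2 : b ^ 2 * w s ^ 2 = 0 := by linarith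
  have hx : x s = 0 := by simpa [ha] using h1
  have hw : w s = 0 := by simpa [hb] using h2
  -- At a common zero of `x` and `w` the vector $r_t$ vanishes and the induced metric degenerates.
  have hT : partialT (doubleRotational a b x w) (s, Real.pi) = 0 := by
    simp only [partialT, doubleRotational_eq_rot, hx, hw]
    rw [(hasDerivAt_rot a b Real.pi 0 0 0 0).deriv]
    ext i; fin_cases i <;> simp [rot]
  have := hM.2 (s, Real.pi) ⟨hs, Real.pi_pos, by linarith [Real.pi_pos]⟩
  simp [metricDet, metricF, metricG, hT, mink] at this

end Minkowski4

end

theorem mainTheorem2 (a b : ℝ) (ha : a ≠ 0) (hb : b ≠ 0)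
    (I : Set ℝ) (hI : IsOpen I) (hIc : I.OrdConnected) (hIn : I.Nonempty)
    (x w : ℝ → ℝ) (hx : ContDiffOn ℝ ∞ x I) (hw : ContDiffOn ℝ ∞ w I)
    (harc : ∀ s ∈ I, deriv x s ^ 2 - deriv w s ^ 2 = -1)
    (hM : Minkowski4.IsTimelikeSurface (Minkowski4.doubleRotational a b x w)
      (Minkowski4.paramDomain I))
    (hflat : Minkowski4.HasFlatNormalBundle (Minkowski4.doubleRotational a b x w)
      (Minkowski4.paramDomain I)) :
    Minkowski4.HasPointwiseOneTypeGaussMapSecondKind (Minkowski4.doubleRotational a b x w)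
        (Minkowski4.paramDomain I) ↔
      Minkowski4.IsOpenPartOfTimelikePlane (Minkowski4.doubleRotational a b x w)
        (Minkowski4.paramDomain I) := by
  have h : Minkowski4.IsProfile a b x w I :=
    ⟨hI, hx, hw, harc, fun s hs => Minkowski4.pos_of_isTimelikeSurface ha hb hM hs⟩
  constructor
  · intro hG
    exact h.isOpenPart_of_x_eq_zero hb fun s hs =>
      h.x_eq_zero_of_secondKind ha hb hIc hflat hG hs
  · rintro ⟨P, ⟨hP, -⟩, hsub, -⟩
    refine h.secondKind_of_x_eq_zero fun s hs => ?_
    obtain ⟨hμ, hl⟩ := h.mixed_rotCurv_eq_zero_of_plane hP hsub hs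
    exact h.x_eq_zero_of_mixed_of_rotCurv ha hb hs hμ hl
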